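/- For $f\in\mathbb R[x]$ put \[ \mathcal D_\Xi[f]=4x(x-1)^2f''+2(x-1)(7x-3)f'+(6x-5)f,\qquad \mathcal D_\Lambda[f]=4x(x-1)^2f''+6(x-1)(3x-1)f'+4(3x-2)f . \] Given $c,d\in\mathbb R$ with $c\neq0$ and real sequences $(A_n)_{n\ge1}$, $(B_n)_{n\ge1}$ with $A_n\ne0$ and $B_n\neq0$ for all $n\ge1$, define \[ P_1^\Xi=P_1^\Lambda=cx-d,\qquad P_{n+1}^\Xi=A_n\,\mathcal D_\Xi[P_n^\Xi],\qquad P_{n+1}^\Lambda=B_n\,\mathcal D_\Lambda[P_n^\Lambda]\qquad(n\ge1). \] Then $P_n^\Xi$ and $P_n^\Lambda$ have degree $n$ and all their zeros are real. For a real polynomial $p$ of degree $n\ge1$ with real zeros $x_1,\dots,x_n$ (counted with multiplicity), its empirical zero measure is $\frac1n\sum_{j=1}^n\delta_{x_j}$ and its empirical distribution function is $x\mapsto\frac1n\#\{j: x_j\le x\}$. There is a probability measure $\mu$ on $\mathbb R$ with $\mu((0,1))=1$, the same for both families and for all admissible $c,d,(A_n),(B_n)$, such that the empirical zero measures of $P_n^\Xi$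 and of $P_n^\Lambda$ converge weakly to $\mu$ as $n\to\infty$. The limiting measure $\mu$ is absolutely continuous with respect to Lebesgue measure, with density \[ \rho(x)=\begin{cases}\dfrac{2}{\sqrt x\,(1-x)\left(\log^2\!\left(\frac{1-\sqrt x}{1+\sqrt x}\right)+\pi^2\right)},&0<x<1,\\[1em]0,&x\notin(0,1),\end{cases} \] and its distribution function is \[ F(x)=\begin{cases}0,&x\le0,\\ \dfrac2\pi\arctan\!\left(\dfrac1\pi\log\!\left(\dfrac{1+\sqrt x}{1-\sqrt x}\right)\right),&0<x<1,\\ 1,&x\ge1.\end{cases} \] In particular, the empirical distribution functions of $P_n^\Xi$ and of $P_n^\Lambda$ converge to $F$ pointwise at every continuity point of $F$. -/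

import Mathlib

open Polynomial MeasureTheory Filter Topology
open scoped NNReal

noncomputable section

/-- The operator `D_Ξ[f] = 4x(x-1)² f'' + 2(x-1)(7x-3) f' + (6x-5) f` on `ℝ[x]`. -/
def opXi (f : ℝ[X]) : ℝ[X] :=
  4 * X * (X - 1) ^ 2 * derivative (derivative f)
    + 2 * (X - 1) * (7 * X - 3) * derivative f + (6 * X - 5) * f

/-- The operator `D_Λ[f] = 4x(x-1)² f'' + 6(x-1)(3x-1) f' + 4(3x-2) f` on `ℝ[x]`. -/
def opLambda (f : ℝ[X]) : ℝ[X] :=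
  4 * X * (X - 1) ^ 2 * derivative (derivative f)
    + 6 * (X - 1) * (3 * X - 1) * derivative f + 4 * (3 * X - 2) * f

/-- The sequence `P₁ = c x - d`, `P_{n+1} = a_n T[P_n]` for `n ≥ 1`.
The index `0` is a placeholder, and `a 0` is not used. -/
def iterSeq (T : ℝ[X] → ℝ[X]) (a : ℕ → ℝ) (c d : ℝ) : ℕ → ℝ[X]
  | 0 => 0
  | 1 => C c * X - C d
  | n + 2 => C (a (n + 1)) * T (iterSeq T a c d (n + 1))

/-- The polynomials `P_n^Ξ`, with normalizing constants `A_n`. -/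
def PXi (A : ℕ → ℝ) (c d : ℝ) : ℕ → ℝ[X] := iterSeq opXi A c d

/-- The polynomials `P_n^Λ`, with normalizing constants `B_n`. -/
def PLambda (B : ℕ → ℝ) (c d : ℝ) : ℕ → ℝ[X] := iterSeq opLambda B c d

/-- The Dirac mass at `x`, as a finite measure. -/
def diracFinite (x : ℝ) : FiniteMeasure ℝ := ⟨Measure.dirac x, inferInstance⟩

/-- The empirical zero measure `(1 / deg p) ∑ δ_x`, the sum over the real zeros `x` of `p`
counted with multiplicity. It is a probability measure when `p` is a nonconstant polynomial
all of whose zeros are real. -/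
def zeroMeasure (p : ℝ[X]) : FiniteMeasure ℝ :=
  (p.natDegree : ℝ≥0)⁻¹ • (p.roots.map diracFinite).sum

/-- The empirical distribution function `x ↦ (1 / deg p) #{zeros of p that are ≤ x}`, the real
zeros being counted with multiplicity. -/
def zeroCdf (p : ℝ[X]) (x : ℝ) : ℝ :=
  (p.roots.countP (fun t => t ≤ x) : ℝ) / (p.natDegree : ℝ)

/-- The limiting density. -/
def limitDensity (x : ℝ) : ℝ :=
  if 0 < x ∧ x < 1 then
    2 / (√x * (1 - x) * (Real.log ((1 - √x) / (1 + √x)) ^ 2 + Real.pi ^ 2))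
  else 0

/-- The limiting distribution function. -/
def limitCdf (x : ℝ) : ℝ :=
  if x ≤ 0 then 0
  else if x < 1 then
    2 / Real.pi * Real.arctan (1 / Real.pi * Real.log ((1 + √x) / (1 - √x)))
  else 1

end

/-! Put `x = tanh² t`. On functions `tanh t · sech^α t · f(tanh² t)` the operator `tanhOp α` is
`d²/dt²`; the families Ξ and Λ are the cases `α = 1` and `α = 2`. For `P₁` this function is a
combination of the third and first derivatives of `sech^α`, so `P_n` corresponds, up to a nonzero
factor, to the derivative of order `2n+1` plus `e` times that of order `2n-1`, with `e` independent
of `n` (`exists_iterSeq_tanhOp_comp_eq`).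

Real zeros: two applications of Rolle per step, using also the zeros at `t = 0` and `t = ∞`, yield
`n - 1` distinct zeros in `(0, 1)`. The degree is `n`, so the remaining zero is real as well.

Distribution: high derivatives of `sech^α` at real `t` are governed by the nearest poles `±iπ/2`.
With `t = (π/2) tan(πy/2)` the argument of `t - iπ/2` is linear in `y`, and the normalized
derivative of order `N` is uniformly close to `cos((N + α)(π/2)(1 - y) - β)` on compact subsets of
`(0, 1)` (`SechAsymptotics`). The term of order `2n-1` is negligible after factorial normalization.
Sign changes then give at least `n(y₂ - y₁) - 2` zeros with `y` in `(y₁, y₂)`. Since there are only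
`n` zeros in all, these lower bounds force equidistribution in `y`. Thus `μ` is the image of the
uniform law under `y ↦ tanh²((π/2) tan(πy/2))`, whose inverse is `F`. -/

/-- If any two elements of a finite set `S` are separated by a point satisfying `p`, then at least
`#S - 1` points strictly between elements of `S` satisfy `p`. -/
lemma exists_finset_card_le_of_forall_exists_between {p : ℝ → Prop} (S : Finset ℝ)
    (h : ∀ x ∈ S, ∀ y ∈ S, x < y → ∃ z, x < z ∧ z < y ∧ p z) :
    ∃ T : Finset ℝ, S.card ≤ T.card + 1 ∧
      ∀ z ∈ T, p z ∧ (∃ x ∈ S, x < z) ∧ ∃ y ∈ S, z < y := by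
  classical
  induction S using Finset.induction_on_max with
  | empty => exact ⟨∅, by simp⟩
  | insert a S ha ih =>
    rcases S.eq_empty_or_nonempty with rfl | hne
    · exact ⟨∅, by simp⟩
    obtain ⟨T, hT, hTS⟩ := ih fun x hx y hy =>
      h x (Finset.mem_insert_of_mem hx) y (Finset.mem_insert_of_mem hy)
    have hm := S.max'_mem hne
    obtain ⟨z, hz1, hz2, hz⟩ := h _ (Finset.mem_insert_of_mem hm) a (Finset.mem_insert_self _ _)
      (ha _ hm)
    have hzT : z ∉ T := fun hzT => by
      obtain ⟨-, -, y, hy, hzy⟩ := hTS z hzT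
      exact absurd (S.le_max' y hy) (by linarith)
    have haS : a ∉ S := fun h' => lt_irrefl _ (ha a h')
    refine ⟨insert z T, ?_, ?_⟩
    · rw [Finset.card_insert_of_notMem haS, Finset.card_insert_of_notMem hzT]
      omega
    · intro w hw
      rcases Finset.mem_insert.1 hw with rfl | hw
      · exact ⟨hz, ⟨_, Finset.mem_insert_of_mem hm, hz1⟩, a, Finset.mem_insert_self _ _, hz2⟩
      · obtain ⟨h1, ⟨x, hx, hxw⟩, y, hy, hyw⟩ := hTS w hw
        exact ⟨h1, ⟨x, Finset.mem_insert_of_mem hx, hxw⟩, y, Finset.mem_insert_of_mem hy, hyw⟩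

/-! ### The substitution `x = tanh² t` and derivatives of `sech^α`. -/

/-- The derivative `d/dt` acting on `sech(t)^α Q(tanh t)`, in the variable `u = tanh t`. -/
noncomputable def sechOp (α : ℕ) (Q : ℝ[X]) : ℝ[X] :=
  (1 - X ^ 2) * derivative Q - (α : ℝ[X]) * X * Q

/-- The second derivative `d²/dt²` acting on `tanh(t) sech(t)^α f(tanh(t)²)`,
in the variable `x = tanh(t)²`. -/
noncomputable def tanhOp (α : ℕ) (f : ℝ[X]) : ℝ[X] :=
  4 * X * (X - 1) ^ 2 * derivative (derivative f)
    + 2 * (X - 1) * ((2 * (α : ℝ[X]) + 5) * X - 3) * derivative f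
    + (((α : ℝ[X]) + 1) * ((α : ℝ[X]) + 2) * X - (3 * (α : ℝ[X]) + 2)) * f

lemma opXi_eq_tanhOp : opXi = tanhOp 1 := by
  funext f; simp only [opXi, tanhOp, Nat.cast_one]; ring

lemma opLambda_eq_tanhOp : opLambda = tanhOp 2 := by
  funext f; simp only [opLambda, tanhOp, Nat.cast_ofNat]; ring

/-- With `u = tanh t` and `x = u²`, both sides represent the second `t`-derivative of `tanh t ·
sech^α t · P(tanh² t)`; two derivatives preserve oddness in `u`. -/
lemma sechOp_sechOp_X_mul_comp (α : ℕ) (P : ℝ[X]) :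
    sechOp α (sechOp α (X * P.comp (X ^ 2))) = X * (tanhOp α P).comp (X ^ 2) := by
  simp only [sechOp, tanhOp, derivative_mul, derivative_sub, derivative_X, derivative_comp,
    derivative_one, derivative_X_pow, derivative_natCast, mul_comp, add_comp, sub_comp, X_comp,
    one_comp, pow_comp, natCast_comp, ofNat_comp, Nat.cast_ofNat]
  simp only [derivative_add, derivative_mul, derivative_X, derivative_comp, derivative_X_pow,
    map_ofNat, Nat.cast_ofNat, map_natCast]
  simp
  ring

/-- `sechOp` as a linear map. -/
noncomputable def sechOpLin (α : ℕ) : ℝ[X] →ₗ[ℝ] ℝ[X] where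
  toFun := sechOp α
  map_add' p q := by simp only [sechOp, derivative_add]; ring
  map_smul' r p := by simp only [sechOp, smul_eq_C_mul, derivative_C_mul, RingHom.id_apply]; ring

lemma sechOp_iterate_C_mul (α k : ℕ) (r : ℝ) (Q : ℝ[X]) :
    (sechOp α)^[k] (C r * Q) = C r * (sechOp α)^[k] Q := by
  have h := ((sechOpLin α) ^ k).map_smul r Q
  rw [Module.End.coe_pow, smul_eq_C_mul, smul_eq_C_mul] at h
  exact h

lemma sechOp_iterate_add (α k : ℕ) (P Q : ℝ[X]) :
    (sechOp α)^[k] (P + Q) = (sechOp α)^[k] P + (sechOp α)^[k] Q := by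
  have h := ((sechOpLin α) ^ k).map_add P Q
  rw [Module.End.coe_pow] at h
  exact h

lemma iterSeq_succ (T : ℝ[X] → ℝ[X]) (a : ℕ → ℝ) (c d : ℝ) {n : ℕ} (hn : 1 ≤ n) :
    iterSeq T a c d (n + 1) = C (a n) * T (iterSeq T a c d n) := by
  obtain ⟨m, rfl⟩ := Nat.exists_eq_add_of_le' hn
  rfl

/-- The derivatives of `sech(t)^α` as polynomials in `tanh t`, divided by `sech(t)^α`. -/
noncomputable def sechPoly (α n : ℕ) : ℝ[X] := (sechOp α)^[n] 1

lemma sechPoly_succ (α n : ℕ) : sechPoly α (n + 1) = sechOp α (sechPoly α n) :=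
  Function.iterate_succ_apply' _ _ _

lemma sechPoly_add (α m n : ℕ) : sechPoly α (m + n) = (sechOp α)^[m] (sechPoly α n) :=
  Function.iterate_add_apply _ _ _ _

lemma sechPoly_one (α : ℕ) : sechPoly α 1 = - (α : ℝ[X]) * X := by
  simp [sechPoly, sechOp]

lemma sechPoly_three (α : ℕ) : sechPoly α 3 =
    (3 * (α : ℝ[X]) ^ 2 + 2 * (α : ℝ[X])) * X - (α : ℝ[X]) * ((α : ℝ[X]) + 1) * ((α : ℝ[X]) + 2) * X ^ 3 := by
  simp only [sechPoly, sechOp, Function.iterate_succ, Function.iterate_zero, Function.comp, id]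
  simp
  ring

/-- In the variable `u = √x`, each polynomial of the sequence is a combination of
two derivatives of `sech ^ α`. -/
lemma exists_iterSeq_tanhOp_comp_eq {α : ℕ} (hα : 1 ≤ α) (a : ℕ → ℝ) (c d : ℝ) (hc : c ≠ 0)
    (ha : ∀ n, 1 ≤ n → a n ≠ 0) :
    ∃ e : ℝ, ∀ n, 1 ≤ n → ∃ k : ℝ, k ≠ 0 ∧
      X * (iterSeq (tanhOp α) a c d n).comp (X ^ 2) =
        C k * (sechPoly α (2 * n + 1) + C e * sechPoly α (2 * n - 1)) := by
  have hα' : (α : ℝ) ≠ 0 := by positivity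
  -- For `n = 1`, `X * (c X² - d)` is an odd cubic, hence a combination of `sechPoly α 3` and
  -- `sechPoly α 1`: the cubic coefficient determines `A`, the linear one `A * e`.
  set A : ℝ := -c / (α * (α + 1) * (α + 2)) with hA
  have hA0 : A ≠ 0 := by
    rw [hA]; exact div_ne_zero (neg_ne_zero.2 hc) (by positivity)
  set e : ℝ := (d + A * (3 * α ^ 2 + 2 * α)) / α / A with he
  refine ⟨e, fun n hn => ?_⟩
  induction n, hn using Nat.le_induction with
  | base =>
    refine ⟨A, hA0, ?_⟩
    have h1 : c = -(A * (α * (α + 1) * (α + 2))) := by rw [hA]; field_simp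
    have h2 : d = A * e * α - A * (3 * α ^ 2 + 2 * α) := by rw [he]; field_simp; ring
    have h1' : (C c : ℝ[X]) = - (C A * ((α : ℝ[X]) * ((α : ℝ[X]) + 1) * ((α : ℝ[X]) + 2))) := by
      rw [h1]; simp [-mul_eq_mul_left_iff, map_ofNat C 2]
    have h2' : (C d : ℝ[X]) = C A * C e * (α : ℝ[X]) - C A * (3 * (α : ℝ[X]) ^ 2 + 2 * (α : ℝ[X])) := by
      rw [h2]; simp [-mul_eq_mul_left_iff, map_ofNat C 2, map_ofNat C 3]
    have e1 : 2 * 1 + 1 = 3 := rfl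
    have e2 : 2 * 1 - 1 = 1 := rfl
    rw [e1, e2, sechPoly_three, sechPoly_one]
    simp only [iterSeq, sub_comp, mul_comp, C_comp, X_comp]
    rw [h1', h2']
    ring
  | succ n hn ih =>
    obtain ⟨k, hk, ih⟩ := ih
    refine ⟨a n * k, mul_ne_zero (ha n hn) hk, ?_⟩
    rw [iterSeq_succ _ _ _ _ hn, mul_comp, C_comp, mul_left_comm, ← sechOp_sechOp_X_mul_comp, ih]
    have := sechOp_iterate_C_mul α 2 k (sechPoly α (2 * n + 1) + C e * sechPoly α (2 * n - 1))
    rw [sechOp_iterate_add, sechOp_iterate_C_mul α 2 e, ← sechPoly_add, ← sechPoly_add] at this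
    simp only [Function.iterate_succ, Function.iterate_zero, Function.comp, id] at this
    rw [this, C_mul, mul_assoc]
    rw [show 2 + (2 * n + 1) = 2 * (n + 1) + 1 by ring,
      show 2 + (2 * n - 1) = 2 * (n + 1) - 1 by omega]

/-! ### Degrees. -/

lemma natDegree_sechOp_le (α n : ℕ) (Q : ℝ[X]) (hQ : Q.natDegree ≤ n) :
    (sechOp α Q).natDegree ≤ n + 1 := by
  have h1 : (derivative Q).natDegree ≤ n - 1 := (natDegree_derivative_le Q).trans (by omega)
  rcases Nat.eq_zero_or_pos n with rfl | hn
  · rw [eq_C_of_natDegree_le_zero hQ, sechOp]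
    simp only [derivative_C, mul_zero, zero_sub]
    compute_degree
  · unfold sechOp
    have h2 : (1 - X ^ 2 : ℝ[X]).natDegree ≤ 2 := by compute_degree
    have h3 : ((α : ℝ[X]) * X).natDegree ≤ 1 := by compute_degree
    exact (natDegree_sub_le _ _).trans (max_le (natDegree_mul_le.trans (by omega))
      (natDegree_mul_le.trans (by omega)))

lemma coeff_sechOp (α n : ℕ) (Q : ℝ[X]) (hQ : Q.natDegree ≤ n) :
    (sechOp α Q).coeff (n + 1) = -(n + α) * Q.coeff n := by
  have e : sechOp α Q = derivative Q - derivative Q * X * X - C (α : ℝ) * (Q * X) := by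
    simp only [sechOp, C_eq_natCast]; ring
  have h0 : Q.coeff (n + 2) = 0 := coeff_eq_zero_of_natDegree_lt (by omega)
  rw [e, coeff_sub, coeff_sub, coeff_C_mul, coeff_mul_X, coeff_mul_X, coeff_derivative, h0]
  cases n with
  | zero => simp
  | succ m => rw [coeff_mul_X, coeff_derivative]; push_cast; ring

lemma natDegree_sechPoly {α : ℕ} (hα : 1 ≤ α) (n : ℕ) : (sechPoly α n).natDegree = n := by
  have h : (sechPoly α n).natDegree ≤ n ∧ (sechPoly α n).coeff n ≠ 0 := by
    induction n with
    | zero => simp [sechPoly]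
    | succ n ih =>
      rw [sechPoly_succ]
      refine ⟨natDegree_sechOp_le _ _ _ ih.1, ?_⟩
      rw [coeff_sechOp _ _ _ ih.1]
      exact mul_ne_zero (neg_ne_zero.2 (by positivity)) ih.2
  exact natDegree_eq_of_le_of_coeff_ne_zero h.1 h.2

lemma natDegree_iterSeq_tanhOp {α : ℕ} (hα : 1 ≤ α) (a : ℕ → ℝ) (c d : ℝ) (hc : c ≠ 0)
    (ha : ∀ n, 1 ≤ n → a n ≠ 0) {n : ℕ} (hn : 1 ≤ n) :
    (iterSeq (tanhOp α) a c d n).natDegree = n := by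
  obtain ⟨e, he⟩ := exists_iterSeq_tanhOp_comp_eq hα a c d hc ha
  obtain ⟨k, hk, h⟩ := he n hn
  have h1 : (C k * (sechPoly α (2 * n + 1) + C e * sechPoly α (2 * n - 1))).natDegree
      = 2 * n + 1 := by
    rw [natDegree_C_mul hk, natDegree_add_eq_left_of_natDegree_lt, natDegree_sechPoly hα]
    refine (natDegree_C_mul_le _ _).trans_lt ?_
    rw [natDegree_sechPoly hα, natDegree_sechPoly hα]; omega
  rw [← h] at h1
  have hne : (iterSeq (tanhOp α) a c d n).comp (X ^ 2) ≠ 0 := by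
    intro h0; rw [h0] at h1; simp at h1
  rw [natDegree_X_mul hne, natDegree_comp, natDegree_X_pow] at h1
  omega

/-! ### Real zeros by Rolle's theorem. -/

/-- Rolle's theorem for `(1 - u²)^(α/2) Q(u)` on `[-1, 1]`. -/
lemma exists_isRoot_sechOp_between {α : ℕ} (Q : ℝ[X]) {x y : ℝ} (hx : -1 ≤ x)
    (hy : y ≤ 1) (hxy : x < y) (h : √(1 - x ^ 2) ^ α * Q.eval x = √(1 - y ^ 2) ^ α * Q.eval y) :
    ∃ z, x < z ∧ z < y ∧ (sechOp α Q).IsRoot z := by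
  obtain ⟨z, ⟨hz1, hz2⟩, hz⟩ := exists_deriv_eq_zero hxy
    (f := fun u => √(1 - u ^ 2) ^ α * Q.eval u) (by fun_prop) h
  refine ⟨z, hz1, hz2, ?_⟩
  have hpos : 0 < 1 - z ^ 2 := by nlinarith
  have hs : 0 < √(1 - z ^ 2) := Real.sqrt_pos.2 hpos
  have hd : HasDerivAt (fun u : ℝ => √(1 - u ^ 2) ^ α * Q.eval u) _ z :=
    ((((hasDerivAt_pow 2 z).const_sub 1).sqrt hpos.ne').pow α).mul (Q.hasDerivAt z)
  rw [hd.deriv] at hz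
  simp only [IsRoot.def, sechOp, eval_sub, eval_mul, eval_one, eval_pow, eval_X, eval_natCast]
  have hsq : √(1 - z ^ 2) ^ 2 = 1 - z ^ 2 := Real.sq_sqrt hpos.le
  rcases α with _ | m
  · simp at hz
    simp [hz]
  · simp only [Nat.add_sub_cancel, Nat.cast_ofNat, Pi.pow_apply] at hz
    generalize √(1 - z ^ 2) = s at hz hsq hs
    -- The derivative of `s^α Q` is `s^(α-2) * sechOp α Q`; the factor `s²` clears the denominator
    -- coming from the square root.
    have : s ^ (m + 1) * ((1 - z ^ 2) * eval z (derivative Q)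
        - ((m + 1 : ℕ) : ℝ) * z * eval z Q) = 0 := by
      rw [← mul_zero (s ^ 2), ← hz, ← hsq]
      field_simp
      ring
    exact (mul_eq_zero.1 this).resolve_left (by positivity)

/-- Applying `tanhOp` increases the number of distinct zeros in `(0, 1)`. -/
lemma exists_roots_tanhOp {α : ℕ} (hα : 1 ≤ α) (P : ℝ[X]) (S : Finset ℝ)
    (hS : ∀ x ∈ S, 0 < x ∧ x < 1 ∧ P.IsRoot x) :
    ∃ T : Finset ℝ, S.card + 1 ≤ T.card ∧ ∀ x ∈ T, 0 < x ∧ x < 1 ∧ (tanhOp α P).IsRoot x := by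
  classical
  have hα0 : α ≠ 0 := by omega
  set Q : ℝ[X] := X * P.comp (X ^ 2) with hQ
  set S' : Finset ℝ := S.image Real.sqrt with hS'
  have hS'card : S'.card = S.card := Finset.card_image_of_injOn fun x hx y hy hxy =>
    (Real.sqrt_inj (hS x hx).1.le (hS y hy).1.le).1 hxy
  have hS'mem : ∀ u ∈ S', 0 < u ∧ u < 1 ∧ Q.eval u = 0 := by
    intro u hu
    obtain ⟨x, hx, rfl⟩ := Finset.mem_image.1 hu
    obtain ⟨h0, h1, h⟩ := hS x hx
    refine ⟨Real.sqrt_pos.2 h0, by rw [Real.sqrt_lt' one_pos]; simpa using h1, ?_⟩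
    rw [IsRoot.def] at h
    simp [hQ, Real.sq_sqrt h0.le, h]
  -- Two extra zeros: `u = 0` because `Q` is odd, and `u = 1` (`t = ∞`) because of the weight. From
  -- `k + 2` points Rolle gives `k + 1` zeros of the first derivative.
  set S1 : Finset ℝ := insert 0 (insert 1 S') with hS1
  have h1S' : (1 : ℝ) ∉ S' := fun h => lt_irrefl _ (hS'mem 1 h).2.1
  have h0S' : (0 : ℝ) ∉ insert 1 S' := by
    intro h
    rcases Finset.mem_insert.1 h with h | h
    · norm_num at h
    · exact lt_irrefl _ (hS'mem 0 h).1
  have hS1mem : ∀ u ∈ S1, 0 ≤ u ∧ u ≤ 1 ∧ √(1 - u ^ 2) ^ α * Q.eval u = 0 := by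
    intro u hu
    rcases Finset.mem_insert.1 hu with rfl | hu
    · simp [hQ]
    rcases Finset.mem_insert.1 hu with rfl | hu
    · simp [hα0]
    · obtain ⟨h0, h1, h⟩ := hS'mem u hu
      exact ⟨h0.le, h1.le, by rw [h, mul_zero]⟩
  obtain ⟨T1, hT1card, hT1⟩ := exists_finset_card_le_of_forall_exists_between
    (p := (sechOp α Q).IsRoot) S1 fun x hx y hy hxy =>
      exists_isRoot_sechOp_between Q (by linarith [(hS1mem x hx).1]) (hS1mem y hy).2.1 hxy
        (by rw [(hS1mem x hx).2.2, (hS1mem y hy).2.2])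
  rw [hS1, Finset.card_insert_of_notMem h0S', Finset.card_insert_of_notMem h1S', hS'card] at hT1card
  have hT1mem : ∀ u ∈ T1, 0 < u ∧ u < 1 ∧ (sechOp α Q).eval u = 0 := by
    intro u hu
    obtain ⟨h, ⟨x, hx, hxu⟩, y, hy, huy⟩ := hT1 u hu
    exact ⟨(hS1mem x hx).1.trans_lt hxu, huy.trans_le (hS1mem y hy).2.1, h⟩
  -- The first derivative is even, so `0` is no longer available; `u = 1` still is. The `k + 2`
  -- points give `k + 1` zeros again.
  set S2 : Finset ℝ := insert 1 T1 with hS2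
  have h1T1 : (1 : ℝ) ∉ T1 := fun h => lt_irrefl _ (hT1mem 1 h).2.1
  have hS2mem : ∀ u ∈ S2, 0 < u ∧ u ≤ 1 ∧ √(1 - u ^ 2) ^ α * (sechOp α Q).eval u = 0 := by
    intro u hu
    rcases Finset.mem_insert.1 hu with rfl | hu
    · simp [hα0]
    · obtain ⟨h0, h1, h⟩ := hT1mem u hu
      exact ⟨h0, h1.le, by rw [h, mul_zero]⟩
  obtain ⟨T2, hT2card, hT2⟩ := exists_finset_card_le_of_forall_exists_between
    (p := (sechOp α (sechOp α Q)).IsRoot) S2 fun x hx y hy hxy =>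
      exists_isRoot_sechOp_between _ (by linarith [(hS2mem x hx).1]) (hS2mem y hy).2.1 hxy
        (by rw [(hS2mem x hx).2.2, (hS2mem y hy).2.2])
  rw [hS2, Finset.card_insert_of_notMem h1T1] at hT2card
  have hT2mem : ∀ u ∈ T2, 0 < u ∧ u < 1 ∧ (tanhOp α P).eval (u ^ 2) = 0 := by
    intro u hu
    obtain ⟨h, ⟨x, hx, hxu⟩, y, hy, huy⟩ := hT2 u hu
    have hu0 := (hS2mem x hx).1.trans hxu
    refine ⟨hu0, huy.trans_le (hS2mem y hy).2.1, ?_⟩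
    rw [sechOp_sechOp_X_mul_comp, IsRoot.def, eval_mul, eval_X, eval_comp, eval_pow, eval_X] at h
    exact (mul_eq_zero.1 h).resolve_left hu0.ne'
  refine ⟨T2.image (fun u => u ^ 2), ?_, ?_⟩
  · rw [Finset.card_image_of_injOn fun x hx y hy hxy =>
      (pow_left_inj₀ (hT2mem x hx).1.le (hT2mem y hy).1.le two_ne_zero).1 hxy]
    omega
  · intro x hx
    obtain ⟨u, hu, rfl⟩ := Finset.mem_image.1 hx
    obtain ⟨h0, h1, h⟩ := hT2mem u hu
    exact ⟨by positivity, by nlinarith, h⟩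

/-- The zero `d / c` of `P₁` may lie anywhere, so the count starts at `0` for `n = 1` and one zero
of `P_n` remains uncontrolled. -/
lemma exists_roots_iterSeq_tanhOp {α : ℕ} (hα : 1 ≤ α) (a : ℕ → ℝ) (c d : ℝ) {n : ℕ} (hn : 1 ≤ n) :
    ∃ T : Finset ℝ, n ≤ T.card + 1 ∧
      ∀ x ∈ T, 0 < x ∧ x < 1 ∧ (iterSeq (tanhOp α) a c d n).IsRoot x := by
  induction n, hn using Nat.le_induction with
  | base => exact ⟨∅, by simp⟩
  | succ n hn ih =>
    obtain ⟨S, hS, hS'⟩ := ih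
    obtain ⟨T, hT, hT'⟩ := exists_roots_tanhOp hα _ S hS'
    refine ⟨T, by omega, fun x hx => ⟨(hT' x hx).1, (hT' x hx).2.1, ?_⟩⟩
    rw [iterSeq_succ _ _ _ _ hn, IsRoot.def, eval_mul, (hT' x hx).2.2, mul_zero]

lemma finset_card_le_countP_roots {p : ℝ[X]} (hp : p ≠ 0) (S : Finset ℝ) (q : ℝ → Prop)
    [DecidablePred q] (hS : ∀ x ∈ S, p.IsRoot x ∧ q x) : S.card ≤ p.roots.countP q := by
  rw [Multiset.countP_eq_card_filter]
  refine Multiset.card_le_card ((Multiset.le_iff_subset S.nodup).2 fun x hx => ?_)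
  rw [Multiset.mem_filter, mem_roots hp]
  exact hS x hx

/-- A real polynomial with at most one zero missing has all its zeros. -/
lemma card_roots_eq_natDegree_of_le {p : ℝ[X]} (h : p.natDegree ≤ p.roots.card + 1) :
    p.roots.card = p.natDegree := by
  obtain ⟨q, hq1, hq2, hq3⟩ := exists_prod_multiset_X_sub_C_mul p
  by_contra hne
  have hq : q.natDegree = 1 := by omega
  obtain ⟨x, hx⟩ := exists_root_of_degree_eq_one ((degree_eq_iff_natDegree_eq_of_pos one_pos).2 hq)
  have : x ∈ q.roots := (mem_roots (ne_zero_of_natDegree_gt (n := 0) (by omega))).2 hx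
  simp [hq3] at this

lemma card_roots_iterSeq_tanhOp {α : ℕ} (hα : 1 ≤ α) (a : ℕ → ℝ) (c d : ℝ) (hc : c ≠ 0)
    (ha : ∀ n, 1 ≤ n → a n ≠ 0) {n : ℕ} (hn : 1 ≤ n) :
    (iterSeq (tanhOp α) a c d n).roots.card = n := by
  have hdeg := natDegree_iterSeq_tanhOp hα a c d hc ha hn
  obtain ⟨T, hT, hT'⟩ := exists_roots_iterSeq_tanhOp hα a c d hn
  rw [card_roots_eq_natDegree_of_le, hdeg]
  have := finset_card_le_countP_roots (ne_zero_of_natDegree_gt (n := 0) (by omega)) T (fun _ => True)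
    fun x hx => ⟨(hT' x hx).2.2, trivial⟩
  rw [Multiset.countP_True] at this
  omega

/-! ### Weak convergence of empirical zero measures. -/

/-- Pointwise convergence of distribution functions implies weak convergence. -/
lemma tendsto_probabilityMeasure_of_tendsto_measureReal_Iic {μs : ℕ → ProbabilityMeasure ℝ}
    {μ : ProbabilityMeasure ℝ}
    (h : ∀ x, Tendsto (fun n => (μs n : Measure ℝ).real (Set.Iic x)) atTop
      (𝓝 ((μ : Measure ℝ).real (Set.Iic x)))) :
    Tendsto μs atTop (𝓝 μ) := by
  have hIoc : ∀ (ν : ProbabilityMeasure ℝ) {a b : ℝ}, a ≤ b →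
      (ν : Measure ℝ).real (Set.Ioc a b) =
        (ν : Measure ℝ).real (Set.Iic b) - (ν : Measure ℝ).real (Set.Iic a) := by
    intro ν a b hab
    rw [show Set.Ioc a b = Set.Iic b \ Set.Iic a by ext; simp [and_comm], measureReal_sdiff (Set.Iic_subset_Iic.2 hab) measurableSet_Iic]
  refine (isPiSystem_Ioc (id : ℝ → ℝ) (id : ℝ → ℝ)).tendsto_probabilityMeasure_of_tendsto_of_mem
    ?_ ?_ ?_
  · rintro s ⟨a, b, -, rfl⟩
    exact measurableSet_Ioc
  · intro u hu x hx
    obtain ⟨ε, hε, hεu⟩ := Metric.isOpen_iff.1 hu x hx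
    refine ⟨Set.Ioc (x - ε / 2) (x + ε / 2), ⟨_, _, show x - ε / 2 < x + ε / 2 by linarith, rfl⟩,
      Ioc_mem_nhds (by linarith) (by linarith), fun y hy => hεu ?_⟩
    rw [Metric.mem_ball, Real.dist_eq, abs_lt]
    constructor <;> linarith [hy.1, hy.2]
  · rintro s ⟨a, b, hab, rfl⟩
    have := (h b).sub (h a)
    simp only [id] at hab
    simp only [← hIoc _ hab.le] at this
    rw [← NNReal.tendsto_coe]
    exact this

lemma coe_sum_map_diracFinite_apply (s : Multiset ℝ) (E : Set ℝ) (hE : MeasurableSet E)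
    [DecidablePred (· ∈ E)] :
    (((s.map diracFinite).sum : FiniteMeasure ℝ) : Measure ℝ) E = s.countP (· ∈ E) := by
  induction s using Multiset.induction_on with
  | empty => simp
  | cons a s ih =>
    rw [Multiset.map_cons, Multiset.sum_cons, FiniteMeasure.toMeasure_add, Measure.add_apply, ih,
      Multiset.countP_cons]
    have : ((diracFinite a : FiniteMeasure ℝ) : Measure ℝ) E = if a ∈ E then 1 else 0 := by
      change Measure.dirac a E = _
      rw [Measure.dirac_apply' _ hE]
      simp [Set.indicator_apply]
    rw [this, add_comm]
    split_ifs <;> simp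

lemma measureReal_zeroMeasure (p : ℝ[X]) (E : Set ℝ) (hE : MeasurableSet E)
    [DecidablePred (· ∈ E)] :
    (zeroMeasure p : Measure ℝ).real E = p.roots.countP (· ∈ E) / p.natDegree := by
  rw [zeroMeasure, FiniteMeasure.toMeasure_smul, measureReal_nnreal_smul_apply, Measure.real,
    coe_sum_map_diracFinite_apply _ _ hE]
  simp [div_eq_inv_mul]

lemma measureReal_zeroMeasure_Iic (p : ℝ[X]) (x : ℝ) :
    (zeroMeasure p : Measure ℝ).real (Set.Iic x) = zeroCdf p x := by
  classical
  rw [measureReal_zeroMeasure _ _ measurableSet_Iic, zeroCdf]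
  congr

lemma isProbabilityMeasure_zeroMeasure {p : ℝ[X]} (hp : 1 ≤ p.natDegree)
    (h : p.roots.card = p.natDegree) : IsProbabilityMeasure (zeroMeasure p : Measure ℝ) := by
  classical
  have : (zeroMeasure p : Measure ℝ).real Set.univ = 1 := by
    rw [measureReal_zeroMeasure _ _ MeasurableSet.univ]
    simp only [Set.mem_univ, Multiset.countP_True, h]
    exact div_self (by positivity)
  refine ⟨?_⟩
  rwa [Measure.real, ENNReal.toReal_eq_one_iff] at this

lemma tendsto_zeroMeasure_of_tendsto_zeroCdf {μ : ProbabilityMeasure ℝ} {p : ℕ → ℝ[X]}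
    (hdeg : ∀ n, 1 ≤ n → (p n).natDegree = n) (hroots : ∀ n, 1 ≤ n → (p n).roots.card = n)
    (h : ∀ x, Tendsto (fun n => zeroCdf (p n) x) atTop (𝓝 ((μ : Measure ℝ).real (Set.Iic x)))) :
    Tendsto (fun n => zeroMeasure (p n)) atTop (𝓝 μ.toFiniteMeasure) := by
  -- Index `0` is dropped: nothing is assumed about `p 0`, so its zero measure need not be a
  -- probability measure.
  rw [← tendsto_add_atTop_iff_nat 1]
  have hprob : ∀ n, IsProbabilityMeasure (zeroMeasure (p (n + 1)) : Measure ℝ) := fun n =>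
    isProbabilityMeasure_zeroMeasure (by rw [hdeg _ (by omega)]; omega)
      (by rw [hdeg _ (by omega), hroots _ (by omega)])
  have key : Tendsto (β := ProbabilityMeasure ℝ)
      (fun n => ⟨(zeroMeasure (p (n + 1)) : Measure ℝ), hprob n⟩) atTop (𝓝 μ) := by
    refine tendsto_probabilityMeasure_of_tendsto_measureReal_Iic fun x => ?_
    have := (tendsto_add_atTop_iff_nat 1).2 (h x)
    simp only [← measureReal_zeroMeasure_Iic] at this
    exact this
  exact (ProbabilityMeasure.tendsto_nhds_iff_toFiniteMeasure_tendsto_nhds _).1 key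

/-! ### The limiting distribution function, its quantile function and its measure. -/

lemma limitCdf_of_mem_Ico {x : ℝ} (h0 : 0 ≤ x) (h1 : x < 1) :
    limitCdf x = 2 / Real.pi * Real.arctan (1 / Real.pi * Real.log ((1 + √x) / (1 - √x))) := by
  rcases h0.eq_or_lt with rfl | h
  · simp [limitCdf]
  · simp [limitCdf, not_le.2 h, h1]

lemma limitCdf_of_nonpos {x : ℝ} (h : x ≤ 0) : limitCdf x = 0 := by simp [limitCdf, h]

lemma limitCdf_of_one_le {x : ℝ} (h : 1 ≤ x) : limitCdf x = 1 := by
  simp [limitCdf, not_le.2 (one_pos.trans_le h), not_lt.2 h]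

lemma limitDensity_nonneg (x : ℝ) : 0 ≤ limitDensity x := by
  unfold limitDensity
  split_ifs with h
  · have : 0 < 1 - x := by linarith [h.2]
    positivity
  · rfl

lemma hasDerivAt_limitCdf {x : ℝ} (h0 : 0 < x) (h1 : x < 1) :
    HasDerivAt limitCdf (limitDensity x) x := by
  have hs0 : 0 < √x := Real.sqrt_pos.2 h0
  have hs1 : √x < 1 := by rw [Real.sqrt_lt' one_pos]; simpa using h1
  have hsub : 0 < 1 - √x := by linarith
  have hs : HasDerivAt (fun y => √y) (1 / (2 * √x)) x := Real.hasDerivAt_sqrt h0.ne'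
  have hlog := (((hs.const_add 1).div (hs.const_sub 1) hsub.ne').log
    (div_pos (by linarith) hsub).ne')
  have hF := ((hlog.const_mul (1 / Real.pi)).arctan).const_mul (2 / Real.pi)
  have heq : limitCdf =ᶠ[𝓝 x]
      fun y => 2 / Real.pi * Real.arctan (1 / Real.pi * Real.log ((1 + √y) / (1 - √y))) := by
    filter_upwards [Ioo_mem_nhds h0 h1] with y hy
    exact limitCdf_of_mem_Ico hy.1.le hy.2
  refine (hF.congr_of_eventuallyEq heq).congr_deriv ?_
  have hl : Real.log ((1 - √x) / (1 + √x)) = - Real.log ((1 + √x) / (1 - √x)) := by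
    rw [← Real.log_inv, inv_div]
  rw [limitDensity, if_pos ⟨h0, h1⟩, hl, neg_sq]
  simp only [Pi.div_apply]
  generalize Real.log ((1 + √x) / (1 - √x)) = l
  have hx : 1 - x = (1 - √x) * (1 + √x) := by
    nlinarith [Real.sq_sqrt h0.le]
  have : 0 < 1 + √x := by linarith
  rw [hx]
  have hpi := Real.pi_pos
  have : 0 < l ^ 2 + Real.pi ^ 2 := by positivity
  have : 0 < 1 + (1 / Real.pi * l) ^ 2 := by positivity
  generalize √x = s at *
  field_simp
  ring

/-- The density is unbounded at `0` and `1`, so the fundamental theorem of calculus needs continuity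
of `limitCdf` up to the endpoints. At `1` the logarithm tends to infinity and the arctangent to
`π/2`. -/
lemma continuousOn_limitCdf : ContinuousOn limitCdf (Set.Icc 0 1) := by
  intro x hx
  rcases hx.2.eq_or_lt with rfl | h1
  · rw [← Set.Ico_insert_right zero_le_one, continuousWithinAt_insert_self, ContinuousWithinAt,
      limitCdf_of_one_le le_rfl]
    have hsqrt : Tendsto (fun x : ℝ => √x) (𝓝[Set.Ico 0 1] 1) (𝓝 1) := by
      have h := (Real.continuous_sqrt.tendsto 1).mono_left (nhdsWithin_le_nhds (s := Set.Ico 0 1))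
      rwa [Real.sqrt_one] at h
    have hden : Tendsto (fun x : ℝ => 1 - √x) (𝓝[Set.Ico 0 1] 1) (𝓝[>] 0) := by
      refine tendsto_nhdsWithin_iff.2 ⟨by simpa using hsqrt.const_sub 1, ?_⟩
      filter_upwards [self_mem_nhdsWithin] with x hx
      have : √x < 1 := by rw [Real.sqrt_lt' one_pos]; simpa using hx.2
      simpa using this
    have hquot : Tendsto (fun x : ℝ => (1 + √x) / (1 - √x)) (𝓝[Set.Ico 0 1] 1) atTop :=
      (hsqrt.const_add 1).pos_mul_atTop (by norm_num) (tendsto_inv_nhdsGT_zero.comp hden)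
    have h := ((Real.tendsto_arctan_atTop.mono_right nhdsWithin_le_nhds).comp
      ((Real.tendsto_log_atTop.comp hquot).const_mul_atTop
        (show 0 < 1 / Real.pi by positivity))).const_mul (2 / Real.pi)
    rw [show 2 / Real.pi * (Real.pi / 2) = 1 by field_simp] at h
    refine h.congr' ?_
    filter_upwards [self_mem_nhdsWithin] with x hx
    exact (limitCdf_of_mem_Ico hx.1 hx.2).symm
  · have hs1 : √x < 1 := by rw [Real.sqrt_lt' one_pos]; simpa using h1
    have hs0 := Real.sqrt_nonneg x
    have heq : limitCdf =ᶠ[𝓝[Set.Icc 0 1] x]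
        fun y => 2 / Real.pi * Real.arctan (1 / Real.pi * Real.log ((1 + √y) / (1 - √y))) := by
      filter_upwards [self_mem_nhdsWithin, mem_nhdsWithin_of_mem_nhds (Iio_mem_nhds h1)] with y hy hy'
      exact limitCdf_of_mem_Ico hy.1 hy'
    refine ContinuousWithinAt.congr_of_eventuallyEq ?_ heq (limitCdf_of_mem_Ico hx.1 h1)
    refine ContinuousAt.continuousWithinAt (continuousAt_const.mul
      (Real.continuous_arctan.continuousAt.comp (continuousAt_const.mul (ContinuousAt.log ?_ ?_))))
    · exact ContinuousAt.div (by fun_prop) (by fun_prop) (by linarith)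
    · exact (div_pos (by linarith) (by linarith)).ne'

/-- The quantile function of the limiting measure. -/
noncomputable def limitQuantile (y : ℝ) : ℝ :=
  Real.tanh (Real.pi / 2 * Real.tan (Real.pi / 2 * y)) ^ 2

/-- In this form `limitCdf` is visibly inverse to `limitQuantile`. -/
lemma limitCdf_eq_arctan_artanh {x : ℝ} (h0 : 0 < x) (h1 : x < 1) :
    limitCdf x = 2 / Real.pi * Real.arctan (2 / Real.pi * Real.artanh √x) := by
  have hs0 : 0 < √x := Real.sqrt_pos.2 h0
  have hs1 : √x < 1 := by rw [Real.sqrt_lt' one_pos]; simpa using h1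
  rw [limitCdf_of_mem_Ico h0.le h1, Real.artanh_eq_half_log ⟨by linarith, hs1.le⟩]
  congr 2
  ring

lemma limitCdf_mem_Ioo {x : ℝ} (h0 : 0 < x) (h1 : x < 1) : 0 < limitCdf x ∧ limitCdf x < 1 := by
  have hs0 : 0 < √x := Real.sqrt_pos.2 h0
  have hs1 : √x < 1 := by rw [Real.sqrt_lt' one_pos]; simpa using h1
  rw [limitCdf_eq_arctan_artanh h0 h1]
  have hpi := Real.pi_pos
  have h := Real.artanh_pos ⟨hs0, hs1⟩
  refine ⟨mul_pos (by positivity) (Real.arctan_pos.2 (by positivity)), ?_⟩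
  have := Real.arctan_lt_pi_div_two (2 / Real.pi * Real.artanh √x)
  calc _ < 2 / Real.pi * (Real.pi / 2) := by gcongr
    _ = 1 := by field_simp

lemma limitQuantile_limitCdf {x : ℝ} (h0 : 0 < x) (h1 : x < 1) :
    limitQuantile (limitCdf x) = x := by
  have hs0 : 0 < √x := Real.sqrt_pos.2 h0
  have hs1 : √x < 1 := by rw [Real.sqrt_lt' one_pos]; simpa using h1
  have hpi := Real.pi_pos
  rw [limitQuantile, limitCdf_eq_arctan_artanh h0 h1, ← mul_assoc,
    show Real.pi / 2 * (2 / Real.pi) = 1 by field_simp, one_mul, Real.tan_arctan, ← mul_assoc,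
    show Real.pi / 2 * (2 / Real.pi) = 1 by field_simp, one_mul,
    Real.tanh_artanh ⟨by linarith, hs1⟩, Real.sq_sqrt h0.le]

lemma tan_pos_of_mem_Ioo {y : ℝ} (h0 : 0 < y) (h1 : y < 1) :
    0 < Real.tan (Real.pi / 2 * y) := by
  have hpi := Real.pi_pos
  exact Real.tan_pos_of_pos_of_lt_pi_div_two (by positivity) (by nlinarith)

lemma tanh_lt_tanh {x y : ℝ} (h : x < y) : Real.tanh x < Real.tanh y := by
  have hx := Real.tanh_bijOn.mapsTo (Set.mem_univ x)
  have hy := Real.tanh_bijOn.mapsTo (Set.mem_univ y)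
  rwa [← Real.artanh_lt_artanh_iff hx hy, Real.artanh_tanh, Real.artanh_tanh]

lemma limitQuantile_lt {y z : ℝ} (h0 : 0 < y) (hyz : y < z) (h1 : z < 1) :
    limitQuantile y < limitQuantile z := by
  have hpi := Real.pi_pos
  have hy := tan_pos_of_mem_Ioo h0 (hyz.trans h1)
  have htan : Real.tan (Real.pi / 2 * y) < Real.tan (Real.pi / 2 * z) :=
    Real.tan_lt_tan_of_lt_of_lt_pi_div_two (by nlinarith) (by nlinarith) (by nlinarith)
  have h1 : Real.tanh 0 < Real.tanh (Real.pi / 2 * Real.tan (Real.pi / 2 * y)) :=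
    tanh_lt_tanh (by positivity)
  have h2 : Real.tanh (Real.pi / 2 * Real.tan (Real.pi / 2 * y))
    < Real.tanh (Real.pi / 2 * Real.tan (Real.pi / 2 * z)) := tanh_lt_tanh (by nlinarith)
  rw [Real.tanh_zero] at h1
  unfold limitQuantile
  gcongr

lemma limitQuantile_mem_Ioo {y : ℝ} (h0 : 0 < y) (h1 : y < 1) :
    0 < limitQuantile y ∧ limitQuantile y < 1 := by
  have hpi := Real.pi_pos
  have hy := tan_pos_of_mem_Ioo h0 h1
  have h1 : Real.tanh 0 < Real.tanh (Real.pi / 2 * Real.tan (Real.pi / 2 * y)) :=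
    tanh_lt_tanh (by positivity)
  rw [Real.tanh_zero] at h1
  have h2 := (Real.tanh_bijOn.mapsTo (Set.mem_univ (Real.pi / 2 * Real.tan (Real.pi / 2 * y)))).2
  unfold limitQuantile
  exact ⟨by positivity, by nlinarith⟩

/-- The limiting measure. -/
noncomputable def limitMeasure : Measure ℝ :=
  (volume : Measure ℝ).withDensity (fun x => ENNReal.ofReal (limitDensity x))

lemma limitMeasure_eq_zero {s : Set ℝ} (hs : MeasurableSet s) (h : ∀ x ∈ s, x ≤ 0 ∨ 1 ≤ x) :
    limitMeasure s = 0 := by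
  rw [limitMeasure, withDensity_apply _ hs, setLIntegral_congr_fun hs (g := fun _ => 0), lintegral_zero]
  intro x hx
  have : ¬ (0 < x ∧ x < 1) := by
    rcases h x hx with h | h
    · exact fun h' => by linarith [h'.1]
    · exact fun h' => by linarith [h'.2]
  simp [limitDensity, this]

/-- Integrability of the density comes for free: it is the nonnegative derivative of a function
continuous on the closed interval. -/
lemma limitMeasure_Ioc {x : ℝ} (h0 : 0 ≤ x) (h1 : x ≤ 1) :
    limitMeasure (Set.Ioc 0 x) = ENNReal.ofReal (limitCdf x) := by
  have hc : ContinuousOn limitCdf (Set.Icc 0 x) :=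
    continuousOn_limitCdf.mono (Set.Icc_subset_Icc_right h1)
  have hd : ∀ y ∈ Set.Ioo 0 x, HasDerivAt limitCdf (limitDensity y) y := fun y hy =>
    hasDerivAt_limitCdf hy.1 (hy.2.trans_le h1)
  have hint := intervalIntegral.integrableOn_deriv_of_nonneg hc hd
    fun y _ => limitDensity_nonneg y
  have := intervalIntegral.integral_eq_sub_of_hasDerivAt_of_le h0 hc hd
    ((intervalIntegrable_iff_integrableOn_Ioc_of_le h0).2 hint)
  rw [limitMeasure, withDensity_apply _ measurableSet_Ioc,
    ← ofReal_integral_eq_lintegral_ofReal hint (Eventually.of_forall limitDensity_nonneg),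
    ← intervalIntegral.integral_of_le h0, this, limitCdf_of_nonpos le_rfl, sub_zero]

lemma limitMeasure_Iic (x : ℝ) : limitMeasure (Set.Iic x) = ENNReal.ofReal (limitCdf x) := by
  have hle : limitMeasure (Set.Iic 0) = 0 := limitMeasure_eq_zero measurableSet_Iic
    fun x hx => Or.inl hx
  have h01 : ∀ x : ℝ, 0 ≤ x → x ≤ 1 →
      limitMeasure (Set.Iic x) = ENNReal.ofReal (limitCdf x) := fun x h0 h1 => by
    rw [← Set.Iic_union_Ioc_eq_Iic h0, measure_union
      (Set.Iic_disjoint_Ioc le_rfl) measurableSet_Ioc, hle, zero_add,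
      limitMeasure_Ioc h0 h1]
  rcases le_total x 0 with h0 | h0
  · rw [limitCdf_of_nonpos h0, ENNReal.ofReal_zero]
    exact measure_mono_null (Set.Iic_subset_Iic.2 h0) hle
  rcases le_total x 1 with h1 | h1
  · exact h01 x h0 h1
  · rw [← Set.Iic_union_Ioc_eq_Iic h1, measure_union
      (Set.Iic_disjoint_Ioc le_rfl) measurableSet_Ioc,
      h01 1 zero_le_one le_rfl, limitMeasure_eq_zero measurableSet_Ioc
      fun y hy => Or.inr hy.1.le, add_zero, limitCdf_of_one_le le_rfl, limitCdf_of_one_le h1]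

instance isProbabilityMeasure_limitMeasure : IsProbabilityMeasure limitMeasure := by
  refine ⟨?_⟩
  rw [← Set.Iic_union_Ioi (a := (1 : ℝ)), measure_union
    (Set.Iic_disjoint_Ioi le_rfl) measurableSet_Ioi, limitMeasure_Iic,
    limitMeasure_eq_zero measurableSet_Ioi fun y hy => Or.inr (le_of_lt hy), add_zero,
    limitCdf_of_one_le le_rfl, ENNReal.ofReal_one]

lemma limitMeasure_Ioo : limitMeasure (Set.Ioo 0 1) = 1 := by
  rw [prob_compl_eq_zero_iff measurableSet_Ioo |>.symm]
  refine limitMeasure_eq_zero measurableSet_Ioo.compl fun x hx => ?_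
  by_contra! h
  exact hx h

/-! ### Removing the poles of `G / cosh` nearest to the real axis. -/

lemma Complex.cosh_half_pi_mul_I : Complex.cosh (Real.pi / 2 * Complex.I) = 0 := by
  rw [Complex.cosh_mul_I, Complex.cos_pi_div_two]

lemma Complex.sinh_half_pi_mul_I : Complex.sinh (Real.pi / 2 * Complex.I) = Complex.I := by
  rw [Complex.sinh_mul_I, Complex.sin_pi_div_two, one_mul]

lemma Differentiable.dslope {f : ℂ → ℂ} (hf : Differentiable ℂ f) (c : ℂ) :
    Differentiable ℂ (dslope f c) := by
  rw [← differentiableOn_univ] at hf ⊢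
  exact (Complex.differentiableOn_dslope univ_mem).2 hf

/-- `cosh` with its two zeros closest to the real axis divided out. -/
noncomputable def coshQuot : ℂ → ℂ :=
  dslope (dslope Complex.cosh (Real.pi / 2 * Complex.I)) (-(Real.pi / 2 * Complex.I))

lemma differentiable_coshQuot : Differentiable ℂ coshQuot :=
  (Complex.differentiable_cosh.dslope _).dslope _

lemma half_pi_mul_I_ne_neg :
    (Real.pi / 2 * Complex.I : ℂ) ≠ -(Real.pi / 2 * Complex.I) := by
  have : (Real.pi / 2 * Complex.I : ℂ) ≠ 0 := by simp [Real.pi_ne_zero]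
  intro h
  exact this (self_eq_neg.1 h)

/-- The first divided difference still vanishes at `-iπ/2`, since `cosh` does and the two points
differ; hence both uses of `dslope` are exact divisions. -/
lemma cosh_eq_mul_coshQuot (z : ℂ) : Complex.cosh z =
    (z - Real.pi / 2 * Complex.I) * (z - -(Real.pi / 2 * Complex.I)) * coshQuot z := by
  set p : ℂ := Real.pi / 2 * Complex.I with hp
  have h1 : ∀ z, (z - p) * dslope Complex.cosh p z = Complex.cosh z := fun z => by
    have := sub_smul_dslope Complex.cosh p z
    rwa [smul_eq_mul, hp, Complex.cosh_half_pi_mul_I, sub_zero, ← hp] at this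
  have h2 : dslope Complex.cosh p (-p) = 0 := by
    have := h1 (-p)
    rw [Complex.cosh_neg, hp, Complex.cosh_half_pi_mul_I, ← hp] at this
    exact (mul_eq_zero.1 this).resolve_left (sub_ne_zero.2 half_pi_mul_I_ne_neg.symm)
  have h3 := sub_smul_dslope (dslope Complex.cosh p) (-p) z
  rw [h2, sub_zero, smul_eq_mul] at h3
  rw [mul_assoc, coshQuot, ← hp, h3, h1]

/-- Differentiating the factorization of `cosh` at one of its two removed zeros leaves a single
term. This identifies the residues of `G / cosh` as `G / sinh`. -/
lemma mul_coshQuot_half_pi_mul_I :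
    (Real.pi / 2 * Complex.I - -(Real.pi / 2 * Complex.I)) * coshQuot (Real.pi / 2 * Complex.I)
      = Complex.sinh (Real.pi / 2 * Complex.I) ∧
    (-(Real.pi / 2 * Complex.I) - Real.pi / 2 * Complex.I) * coshQuot (-(Real.pi / 2 * Complex.I))
      = Complex.sinh (-(Real.pi / 2 * Complex.I)) := by
  set p : ℂ := Real.pi / 2 * Complex.I with hp
  have h : ∀ z, HasDerivAt Complex.cosh
      ((1 * (z - -p) + (z - p) * 1) * coshQuot z + (z - p) * (z - -p) * deriv coshQuot z) z := by
    intro z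
    have := ((((hasDerivAt_id z).sub_const p).mul ((hasDerivAt_id z).sub_const (-p))).mul
      (differentiable_coshQuot z).hasDerivAt)
    refine this.congr_of_eventuallyEq (Eventually.of_forall fun w => ?_)
    exact cosh_eq_mul_coshQuot w
  constructor
  · rw [← (h p).unique (Complex.hasDerivAt_cosh p)]; ring
  · rw [← (h (-p)).unique (Complex.hasDerivAt_cosh (-p))]; ring

lemma coshQuot_half_pi_mul_I_ne_zero :
    coshQuot (Real.pi / 2 * Complex.I) ≠ 0 ∧ coshQuot (-(Real.pi / 2 * Complex.I)) ≠ 0 := by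
  obtain ⟨h1, h2⟩ := mul_coshQuot_half_pi_mul_I
  rw [Complex.sinh_half_pi_mul_I] at h1
  rw [Complex.sinh_neg, Complex.sinh_half_pi_mul_I] at h2
  constructor <;> intro h
  · rw [h, mul_zero] at h1; exact Complex.I_ne_zero h1.symm
  · rw [h, mul_zero] at h2; exact Complex.I_ne_zero (neg_eq_zero.1 h2.symm)

/-- The zeros of `cosh` other than `±iπ/2` have modulus at least `3π/2`, so their distance to the
real `t` is at least `√(t² + 9π²/4)`. The radius `√(t² + π²)` lies strictly between this and the
distance `√(t² + π²/4)` to `±iπ/2`, which makes the remainder below exponentially smaller than the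
pole terms. -/
lemma coshQuot_ne_zero {t : ℝ} {z : ℂ} (hz : ‖z - t‖ ≤ √(t ^ 2 + Real.pi ^ 2)) :
    coshQuot z ≠ 0 := by
  intro h
  have hcosh : Complex.cosh z = 0 := by rw [cosh_eq_mul_coshQuot, h, mul_zero]
  rw [← Complex.cos_mul_I, Complex.cos_eq_zero_iff] at hcosh
  obtain ⟨k, hk⟩ := hcosh
  have hzk : z = ((-((2 * k + 1) * Real.pi / 2) : ℝ) : ℂ) * Complex.I := by
    have : z = -(z * Complex.I * Complex.I) := by rw [mul_assoc, Complex.I_mul_I]; ring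
    rw [this, hk]; push_cast; ring
  have hre : z.re = 0 := by rw [hzk]; simp
  have him : z.im = -((2 * k + 1) * Real.pi / 2) := by rw [hzk]; simp
  have hn : ‖z - t‖ ^ 2 ≤ t ^ 2 + Real.pi ^ 2 := by
    rw [← Real.sq_sqrt (show 0 ≤ t ^ 2 + Real.pi ^ 2 by positivity)]
    gcongr
  rw [Complex.sq_norm, Complex.normSq_apply, Complex.sub_re, Complex.sub_im, Complex.ofReal_re,
    Complex.ofReal_im, hre, him] at hn
  have hk4 : ((2 * k + 1 : ℤ) : ℝ) ^ 2 ≤ 4 := by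
    have hpi := Real.pi_pos
    have : Real.pi ^ 2 * ((2 * k + 1 : ℤ) : ℝ) ^ 2 ≤ Real.pi ^ 2 * 4 := by
      push_cast; nlinarith
    exact le_of_mul_le_mul_left this (by positivity)
  have hk4' : (2 * k + 1) ^ 2 ≤ 4 := by exact_mod_cast hk4
  have h1 : k ≤ 0 := by nlinarith
  have h2 : -1 ≤ k := by nlinarith
  obtain ⟨hp, hq⟩ := coshQuot_half_pi_mul_I_ne_zero
  obtain rfl | rfl : k = 0 ∨ k = -1 := by omega
  · apply hq; rw [← h, hzk]; congr 1; push_cast; ring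
  · apply hp; rw [← h, hzk]; congr 1; push_cast; ring

/-- The regular part of `G / cosh` after removing its poles at `±iπ/2`. -/
noncomputable def coshRegularPart (G : ℂ → ℂ) : ℂ → ℂ :=
  dslope (dslope (fun z => G z / coshQuot z) (Real.pi / 2 * Complex.I)) (-(Real.pi / 2 * Complex.I))

lemma isOpen_coshQuot_ne_zero : IsOpen {z | coshQuot z ≠ 0} :=
  isOpen_ne_fun differentiable_coshQuot.continuous continuous_const

lemma differentiableOn_coshRegularPart {G : ℂ → ℂ} (hG : Differentiable ℂ G) :
    DifferentiableOn ℂ (coshRegularPart G) {z | coshQuot z ≠ 0} := by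
  obtain ⟨hp, hq⟩ := coshQuot_half_pi_mul_I_ne_zero
  refine (Complex.differentiableOn_dslope (isOpen_coshQuot_ne_zero.mem_nhds hq)).2
    ((Complex.differentiableOn_dslope (isOpen_coshQuot_ne_zero.mem_nhds hp)).2 ?_)
  exact hG.differentiableOn.div differentiable_coshQuot.differentiableOn fun z hz => hz

/-- Partial fractions: the second divided difference of `M = G / coshQuot` at `p`, `q`, `z` is `M z
/ ((z - p) * (z - q))` minus its polar parts at `p` and `q`. -/
lemma div_cosh_eq_add_coshRegularPart (G : ℂ → ℂ) {z : ℂ} (hz : Complex.cosh z ≠ 0) :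
    G z / Complex.cosh z =
      G (Real.pi / 2 * Complex.I) / Complex.sinh (Real.pi / 2 * Complex.I) *
          (z - Real.pi / 2 * Complex.I)⁻¹ +
        G (-(Real.pi / 2 * Complex.I)) / Complex.sinh (-(Real.pi / 2 * Complex.I)) *
          (z - -(Real.pi / 2 * Complex.I))⁻¹ + coshRegularPart G z := by
  obtain ⟨hp, hq⟩ := coshQuot_half_pi_mul_I_ne_zero
  rw [← mul_coshQuot_half_pi_mul_I.1, ← mul_coshQuot_half_pi_mul_I.2]
  rw [cosh_eq_mul_coshQuot] at hz ⊢
  have hpq := half_pi_mul_I_ne_neg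
  rw [coshRegularPart]
  generalize (Real.pi / 2 * Complex.I : ℂ) = p at *
  generalize -p = q at *
  have hzp : z - p ≠ 0 := fun h => hz (by rw [h]; ring)
  have hzq : z - q ≠ 0 := fun h => hz (by rw [h]; ring)
  have hzc : coshQuot z ≠ 0 := fun h => hz (by rw [h]; ring)
  have hpq' : p - q ≠ 0 := sub_ne_zero.2 hpq
  have hqp' : q - p ≠ 0 := sub_ne_zero.2 hpq.symm
  set M : ℂ → ℂ := fun z => G z / coshQuot z with hM
  have h1 : dslope M p z = (M z - M p) / (z - p) := by
    rw [eq_div_iff hzp, mul_comm]; exact sub_smul_dslope M p z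
  have h2 : dslope M p q = (M q - M p) / (q - p) := by
    rw [eq_div_iff hqp', mul_comm]; exact sub_smul_dslope M p q
  have h3 : dslope (dslope M p) q z = (dslope M p z - dslope M p q) / (z - q) := by
    rw [eq_div_iff hzq, mul_comm]; exact sub_smul_dslope (dslope M p) q z
  have e1 : G z / ((z - p) * (z - q) * coshQuot z) = M z / ((z - p) * (z - q)) := by
    rw [hM]; field_simp
  have e2 : G p / ((p - q) * coshQuot p) = M p / (p - q) := by rw [hM]; field_simp
  have e3 : G q / ((q - p) * coshQuot q) = M q / (q - p) := by rw [hM]; field_simp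
  rw [e1, e2, e3, h3, h1, h2]
  generalize M z = a
  generalize M p = b
  generalize M q = c
  have : q - p = -(p - q) := by ring
  rw [this]
  field_simp
  ring

/-! ### High derivatives of `G / cosh` on the real axis. -/

lemma iteratedDeriv_inv_sub (K : ℕ) (c z : ℂ) :
    iteratedDeriv K (fun w => (w - c)⁻¹) z = (-1) ^ K * K.factorial * ((z - c)⁻¹) ^ (K + 1) := by
  have h := congrFun (iter_deriv_inv_linear_sub K (1 : ℂ) c) z
  simp only [one_mul, one_pow, mul_one] at h
  rw [iteratedDeriv_eq_iterate, h, show (-1 - K : ℤ) = -((K + 1 : ℕ) : ℤ) by push_cast; ring,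
    zpow_neg, zpow_natCast, inv_pow]

lemma cosh_ofReal_ne_zero (t : ℝ) : Complex.cosh t ≠ 0 := by
  rw [← Complex.ofReal_cosh]
  exact_mod_cast (Real.cosh_pos t).ne'

lemma eventually_cosh_ne_zero {z : ℂ} (hz : Complex.cosh z ≠ 0) :
    ∀ᶠ w in 𝓝 z, Complex.cosh w ≠ 0 :=
  Complex.continuous_cosh.continuousAt.eventually_ne hz

lemma iteratedDeriv_div_cosh {G : ℂ → ℂ} (hG : Differentiable ℂ G) (K : ℕ) (t : ℝ) :
    iteratedDeriv K (fun z => G z / Complex.cosh z) t =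
      (-1) ^ K * K.factorial *
        (G (Real.pi / 2 * Complex.I) / Complex.sinh (Real.pi / 2 * Complex.I) *
          ((t - Real.pi / 2 * Complex.I)⁻¹) ^ (K + 1) +
        G (-(Real.pi / 2 * Complex.I)) / Complex.sinh (-(Real.pi / 2 * Complex.I)) *
          ((t - -(Real.pi / 2 * Complex.I))⁻¹) ^ (K + 1)) +
      iteratedDeriv K (coshRegularPart G) t := by
  have ht := cosh_ofReal_ne_zero t
  have heq : (fun z => G z / Complex.cosh z) =ᶠ[𝓝 (t : ℂ)] _ :=
    (eventually_cosh_ne_zero ht).mono fun z hz => div_cosh_eq_add_coshRegularPart G hz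
  have ht' := ht
  rw [cosh_eq_mul_coshQuot] at ht'
  have hzp : (t : ℂ) - Real.pi / 2 * Complex.I ≠ 0 := fun h => ht' (by rw [h]; ring)
  have hzq : (t : ℂ) - -(Real.pi / 2 * Complex.I) ≠ 0 := fun h => ht' (by rw [h]; ring)
  have hzc : coshQuot t ≠ 0 := fun h => ht' (by rw [h]; ring)
  have h1 : ∀ (r c : ℂ), (t : ℂ) - c ≠ 0 →
      ContDiffAt ℂ K (fun z => r * (z - c)⁻¹) (t : ℂ) := fun r c hc =>
    contDiffAt_const.mul ((contDiffAt_id.sub contDiffAt_const).inv hc)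
  have h2 : ContDiffAt ℂ K (coshRegularPart G) (t : ℂ) :=
    ((differentiableOn_coshRegularPart hG).analyticAt
      (isOpen_coshQuot_ne_zero.mem_nhds hzc)).contDiffAt
  rw [heq.iteratedDeriv_eq, iteratedDeriv_fun_add ((h1 _ _ hzp).add (h1 _ _ hzq)) h2,
    iteratedDeriv_fun_add (h1 _ _ hzp) (h1 _ _ hzq), iteratedDeriv_const_mul_field,
    iteratedDeriv_const_mul_field, iteratedDeriv_inv_sub, iteratedDeriv_inv_sub]
  ring

/-- Cauchy's estimate on the circle of radius `√(t² + π²)` about `t`. One constant serves all `|t| ≤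
B` because the union of the closed discs is a compact subset of the domain of holomorphy. -/
lemma exists_norm_iteratedDeriv_coshRegularPart_le {G : ℂ → ℂ} (hG : Differentiable ℂ G) (B : ℝ) :
    ∃ C : ℝ, 0 ≤ C ∧ ∀ (K : ℕ) (t : ℝ), |t| ≤ B →
      ‖iteratedDeriv K (coshRegularPart G) t‖ ≤
        K.factorial * C / √(t ^ 2 + Real.pi ^ 2) ^ K := by
  have hpi := Real.pi_pos
  have hd := differentiableOn_coshRegularPart hG
  have hsub : ∀ t : ℝ, Metric.closedBall (t : ℂ) √(t ^ 2 + Real.pi ^ 2) ⊆ {z | coshQuot z ≠ 0} :=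
    fun t z hz => coshQuot_ne_zero (by rwa [mem_closedBall_iff_norm] at hz)
  set S : Set ℂ := (fun x : ℝ × ℂ => (x.1 : ℂ) + (√(x.1 ^ 2 + Real.pi ^ 2) : ℝ) * x.2) ''
    (Set.Icc (-B) B ×ˢ Metric.closedBall 0 1) with hS
  have hScomp : IsCompact S := by
    refine (isCompact_Icc.prod (isCompact_closedBall _ _)).image ?_
    fun_prop
  have hSU : S ⊆ {z | coshQuot z ≠ 0} := by
    rintro _ ⟨⟨t, w⟩, ⟨-, hw⟩, rfl⟩
    refine hsub t ?_
    rw [mem_closedBall_iff_norm, add_sub_cancel_left, norm_mul, Complex.norm_real,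
      Real.norm_of_nonneg (Real.sqrt_nonneg _)]
    rw [mem_closedBall_zero_iff] at hw
    exact mul_le_of_le_one_right (Real.sqrt_nonneg _) hw
  obtain ⟨C, hC⟩ := hScomp.exists_bound_of_continuousOn (hd.continuousOn.mono hSU)
  refine ⟨max C 0, le_max_right _ _, fun K t ht => ?_⟩
  have hR : 0 < √(t ^ 2 + Real.pi ^ 2) := Real.sqrt_pos.2 (by positivity)
  refine Complex.norm_iteratedDeriv_le_of_forall_mem_sphere_norm_le K hR
    (hd.diffContOnCl_ball (hsub t)) fun z hz => (hC z ?_).trans (le_max_left _ _)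
  rw [mem_sphere_iff_norm] at hz
  have hR' : ((√(t ^ 2 + Real.pi ^ 2) : ℝ) : ℂ) ≠ 0 := by exact_mod_cast hR.ne'
  refine ⟨(t, (z - t) / (√(t ^ 2 + Real.pi ^ 2) : ℝ)), ⟨abs_le.1 ht, ?_⟩, ?_⟩
  · rw [mem_closedBall_zero_iff, norm_div, hz, Complex.norm_real, Real.norm_of_nonneg hR.le,
      div_self hR.ne']
  · simp only
    rw [mul_div_cancel₀ _ hR']
    ring

lemma cos_half_pi_mul_pos {y : ℝ} (h0 : 0 < y) (h1 : y < 1) : 0 < Real.cos (Real.pi / 2 * y) := by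
  have hpi := Real.pi_pos
  exact Real.cos_pos_of_mem_Ioo ⟨by nlinarith, by nlinarith⟩

/-- The reason for `t = (π/2) tan s`, `s = πy/2`: then `t ∓ iπ/2 = (π / (2 cos s)) (sin s ∓ i cos
s)`, whose argument `∓(π/2 - s)` is linear in `y`. -/
lemma inv_tan_sub_half_pi_mul_I {y : ℝ} (hc : Real.cos (Real.pi / 2 * y) ≠ 0) :
    (((Real.pi / 2 * Real.tan (Real.pi / 2 * y) : ℝ) : ℂ) - Real.pi / 2 * Complex.I)⁻¹ =
        ((Real.pi / (2 * Real.cos (Real.pi / 2 * y)) : ℝ) : ℂ)⁻¹ *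
          Complex.exp ((Real.pi / 2 * (1 - y) : ℝ) * Complex.I) ∧
    (((Real.pi / 2 * Real.tan (Real.pi / 2 * y) : ℝ) : ℂ) - -(Real.pi / 2 * Complex.I))⁻¹ =
        ((Real.pi / (2 * Real.cos (Real.pi / 2 * y)) : ℝ) : ℂ)⁻¹ *
          Complex.exp (-(Real.pi / 2 * (1 - y) : ℝ) * Complex.I) := by
  have hpi : (Real.pi : ℂ) ≠ 0 := by exact_mod_cast Real.pi_ne_zero
  have e : Real.pi / 2 * (1 - y) = Real.pi / 2 - Real.pi / 2 * y := by ring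
  rw [Real.tan_eq_sin_div_cos, ← Complex.ofReal_neg, Complex.exp_mul_I, Complex.exp_mul_I,
    ← Complex.ofReal_cos, ← Complex.ofReal_sin, ← Complex.ofReal_cos, ← Complex.ofReal_sin,
    Real.cos_neg, Real.sin_neg, e, Real.cos_pi_div_two_sub, Real.sin_pi_div_two_sub]
  generalize Real.pi / 2 * y = s at *
  have h1 : (Real.sin s : ℂ) ^ 2 + (Real.cos s : ℂ) ^ 2 = 1 := by
    exact_mod_cast Real.sin_sq_add_cos_sq s
  have hc' : (Real.cos s : ℂ) ≠ 0 := by exact_mod_cast hc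
  constructor
  · refine inv_eq_of_mul_eq_one_right ?_
    push_cast at h1 hc' ⊢
    field_simp
    linear_combination h1 - Complex.cos s ^ 2 * Complex.I_sq
  · refine inv_eq_of_mul_eq_one_right ?_
    push_cast at h1 hc' ⊢
    field_simp
    linear_combination h1 - Complex.cos s ^ 2 * Complex.I_sq

lemma pole_terms_eq_cos {y β : ℝ} (hc : Real.cos (Real.pi / 2 * y) ≠ 0) (K : ℕ) :
    ((Real.pi / (2 * Real.cos (Real.pi / 2 * y)) : ℝ) : ℂ) ^ (K + 1) *
      (Complex.exp (-β * Complex.I) *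
        ((((Real.pi / 2 * Real.tan (Real.pi / 2 * y) : ℝ) : ℂ) - Real.pi / 2 * Complex.I)⁻¹)
          ^ (K + 1) +
      Complex.exp (β * Complex.I) *
        ((((Real.pi / 2 * Real.tan (Real.pi / 2 * y) : ℝ) : ℂ) - -(Real.pi / 2 * Complex.I))⁻¹)
          ^ (K + 1)) =
    ((2 * Real.cos ((K + 1) * (Real.pi / 2 * (1 - y)) - β) : ℝ) : ℂ) := by
  obtain ⟨h1, h2⟩ := inv_tan_sub_half_pi_mul_I hc
  have hρ : ((Real.pi / (2 * Real.cos (Real.pi / 2 * y)) : ℝ) : ℂ) ≠ 0 := by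
    exact_mod_cast div_ne_zero Real.pi_ne_zero (mul_ne_zero two_ne_zero hc)
  rw [h1, h2]
  generalize ((Real.pi / (2 * Real.cos (Real.pi / 2 * y)) : ℝ) : ℂ) = ρ at *
  generalize Real.pi / 2 * (1 - y) = θ
  rw [mul_pow, mul_pow, ← Complex.exp_nat_mul, ← Complex.exp_nat_mul]
  push_cast
  rw [Complex.two_cos]
  have e1 : Complex.exp (((K + 1) * θ - β) * Complex.I) =
      Complex.exp (-β * Complex.I) * Complex.exp ((K + 1) * (θ * Complex.I)) := by
    rw [← Complex.exp_add]; congr 1; ring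
  have e2 : Complex.exp (-((K + 1) * θ - β) * Complex.I) =
      Complex.exp (β * Complex.I) * Complex.exp ((K + 1) * (-θ * Complex.I)) := by
    rw [← Complex.exp_add]; congr 1; ring
  have e3 : ρ ^ (K + 1) * ρ⁻¹ ^ (K + 1) = 1 := by rw [← mul_pow, mul_inv_cancel₀ hρ, one_pow]
  rw [e1, e2]
  linear_combination (Complex.exp (-β * Complex.I) * Complex.exp ((K + 1) * (θ * Complex.I)) +
    Complex.exp (β * Complex.I) * Complex.exp ((K + 1) * (-θ * Complex.I))) * e3

lemma sq_half_pi_mul_tan {y : ℝ} (hc : Real.cos (Real.pi / 2 * y) ≠ 0) :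
    (Real.pi / (2 * Real.cos (Real.pi / 2 * y))) ^ 2 =
      (Real.pi / 2 * Real.tan (Real.pi / 2 * y)) ^ 2 + Real.pi ^ 2 / 4 := by
  rw [Real.tan_eq_sin_div_cos]
  have := Real.sin_sq_add_cos_sq (Real.pi / 2 * y)
  generalize Real.pi / 2 * y = s at *
  field_simp
  linear_combination -4 * this

/-- The normalized high derivatives of `G / cosh` converge uniformly on compact sets to pure
oscillations in the variable `y` with `t = (π/2) tan(πy/2)`. -/
lemma eventually_norm_iteratedDeriv_div_cosh_sub_cos_le {G : ℂ → ℂ} (hG : Differentiable ℂ G)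
    {β : ℝ}
    (hp : G (Real.pi / 2 * Complex.I) / Complex.sinh (Real.pi / 2 * Complex.I) =
      Complex.exp (-β * Complex.I))
    (hq : G (-(Real.pi / 2 * Complex.I)) / Complex.sinh (-(Real.pi / 2 * Complex.I)) =
      Complex.exp (β * Complex.I))
    {y₁ y₂ ε : ℝ} (hy₁ : 0 < y₁) (hy₂ : y₂ < 1) (hε : 0 < ε) :
    ∀ᶠ K : ℕ in atTop, ∀ y ∈ Set.Icc y₁ y₂,
      ‖(((-1) ^ K * (Real.pi / (2 * Real.cos (Real.pi / 2 * y))) ^ (K + 1) /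
            (2 * K.factorial) : ℝ) : ℂ) *
          iteratedDeriv K (fun z => G z / Complex.cosh z)
            ((Real.pi / 2 * Real.tan (Real.pi / 2 * y) : ℝ) : ℂ) -
        ((Real.cos ((K + 1) * (Real.pi / 2 * (1 - y)) - β) : ℝ) : ℂ)‖ ≤ ε := by
  have hpi := Real.pi_pos
  set B := Real.pi / 2 * Real.tan (Real.pi / 2 * y₂) with hB
  obtain ⟨C, hC0, hC⟩ := exists_norm_iteratedDeriv_coshRegularPart_le hG B
  -- The ratio of the pole distance `ρ` to the Cauchy radius increases with `t ≥ 0`, so its value `q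
  -- < 1` at the right end `B` bounds it throughout; `D` likewise bounds `ρ`.
  set q := √((B ^ 2 + Real.pi ^ 2 / 4) / (B ^ 2 + Real.pi ^ 2)) with hqdef
  set D := √(B ^ 2 + Real.pi ^ 2 / 4) with hD
  have hq1 : q < 1 := by
    rw [hqdef, Real.sqrt_lt' one_pos, one_pow, div_lt_one (by positivity)]
    nlinarith
  have hlim : Tendsto (fun K : ℕ => C * D / 2 * q ^ K) atTop (𝓝 0) := by
    simpa using (tendsto_pow_atTop_nhds_zero_of_lt_one (Real.sqrt_nonneg _) hq1).const_mul
      (C * D / 2)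
  filter_upwards [hlim.eventually (ge_mem_nhds hε)] with K hK y hy
  have hy0 : 0 < y := hy₁.trans_le hy.1
  have hy1 : y < 1 := hy.2.trans_lt hy₂
  have hcos := cos_half_pi_mul_pos hy0 hy1
  set ρ := Real.pi / (2 * Real.cos (Real.pi / 2 * y)) with hρ
  set t := Real.pi / 2 * Real.tan (Real.pi / 2 * y) with ht
  have hρ0 : 0 < ρ := by positivity
  have htan := tan_pos_of_mem_Ioo hy0 hy1
  have ht0 : 0 < t := by positivity
  have htB : t ≤ B := by
    rcases hy.2.eq_or_lt with rfl | h
    · rfl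
    · have := Real.tan_lt_tan_of_lt_of_lt_pi_div_two
        (show -(Real.pi / 2) < Real.pi / 2 * y by nlinarith)
        (show Real.pi / 2 * y₂ < Real.pi / 2 by nlinarith)
        (show Real.pi / 2 * y < Real.pi / 2 * y₂ by nlinarith)
      rw [ht, hB]; nlinarith
  have hρsq : ρ ^ 2 = t ^ 2 + Real.pi ^ 2 / 4 := sq_half_pi_mul_tan hcos.ne'
  have hKf : (0 : ℝ) < K.factorial := by positivity
  have hR : 0 < √(t ^ 2 + Real.pi ^ 2) := Real.sqrt_pos.2 (by positivity)
  have hpole := pole_terms_eq_cos (β := β) hcos.ne' K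
  rw [← hρ, ← ht] at hpole
  have hsplit : (((-1) ^ K * ρ ^ (K + 1) / (2 * K.factorial) : ℝ) : ℂ) *
          iteratedDeriv K (fun z => G z / Complex.cosh z) (t : ℂ) -
        ((Real.cos ((K + 1) * (Real.pi / 2 * (1 - y)) - β) : ℝ) : ℂ) =
      (((-1) ^ K * ρ ^ (K + 1) / (2 * K.factorial) : ℝ) : ℂ) *
        iteratedDeriv K (coshRegularPart G) (t : ℂ) := by
    rw [iteratedDeriv_div_cosh hG, hp, hq, mul_add, add_sub_right_comm, add_eq_right, sub_eq_zero]
    rw [Complex.ofReal_mul 2] at hpole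
    have h2 : ((Real.cos ((K + 1) * (Real.pi / 2 * (1 - y)) - β) : ℝ) : ℂ) =
      (((2 : ℝ) : ℂ) * (Real.cos ((K + 1) * (Real.pi / 2 * (1 - y)) - β) : ℝ)) / 2 := by
      push_cast; ring
    rw [h2, ← hpole]
    have hKf' : (K.factorial : ℂ) ≠ 0 := by exact_mod_cast hKf.ne'
    have hsign : ((-1 : ℂ) ^ K) * (-1) ^ K = 1 := by
      rw [← mul_pow]; simp
    push_cast
    field_simp
    rw [sq, hsign, one_mul]
  rw [hsplit, norm_mul, Complex.norm_real, Real.norm_eq_abs, abs_div, abs_mul, abs_pow, abs_neg,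
    abs_one, one_pow, one_mul, abs_of_pos (pow_pos hρ0 _),
    abs_of_pos (by positivity : (0 : ℝ) < 2 * K.factorial)]
  have hρR : ρ / √(t ^ 2 + Real.pi ^ 2) ≤ q := by
    rw [← Real.sqrt_sq hρ0.le, hρsq, ← Real.sqrt_div (by positivity)]
    refine Real.sqrt_le_sqrt ?_
    rw [div_le_div_iff₀ (by positivity) (by positivity)]
    have : t ^ 2 ≤ B ^ 2 := by gcongr
    nlinarith [mul_nonneg (sub_nonneg.2 this) (sq_nonneg Real.pi)]
  have hρD : ρ ≤ D := by
    rw [← Real.sqrt_sq hρ0.le, hρsq]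
    refine Real.sqrt_le_sqrt ?_
    gcongr
  calc _ ≤ ρ ^ (K + 1) / (2 * K.factorial) *
        (K.factorial * C / √(t ^ 2 + Real.pi ^ 2) ^ K) := by
        gcongr
        exact hC K t (by rwa [abs_of_pos ht0])
    _ = C * ρ / 2 * (ρ / √(t ^ 2 + Real.pi ^ 2)) ^ K := by
        clear_value ρ; rw [div_pow]; field_simp; ring
    _ ≤ C * D / 2 * q ^ K := by gcongr
    _ ≤ ε := hK

/-! ### Cosine asymptotics for derivatives of `sech` and `sech²`. -/

/-- Derivatives of `sech^α` in terms of the polynomials `sechPoly`. -/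
lemma iteratedDeriv_sech_pow (α n : ℕ) {z : ℂ} (hz : Complex.cosh z ≠ 0) :
    iteratedDeriv n (fun z => (Complex.cosh z)⁻¹ ^ α) z =
      (Complex.cosh z)⁻¹ ^ α * aeval (Complex.sinh z / Complex.cosh z) (sechPoly α n) := by
  induction n generalizing z with
  | zero => simp [sechPoly]
  | succ n ih =>
    have heq : iteratedDeriv n (fun z => (Complex.cosh z)⁻¹ ^ α) =ᶠ[𝓝 z] fun z =>
        (Complex.cosh z)⁻¹ ^ α * aeval (Complex.sinh z / Complex.cosh z) (sechPoly α n) :=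
      (eventually_cosh_ne_zero hz).mono fun w hw => ih hw
    rw [iteratedDeriv_succ, heq.deriv_eq]
    have htanh := (Complex.hasDerivAt_sinh z).div (Complex.hasDerivAt_cosh z) hz
    have hQ := ((sechPoly α n).hasDerivAt_aeval (Complex.sinh z / Complex.cosh z)).comp z htanh
    have h := ((((Complex.hasDerivAt_cosh z).inv hz).pow α).mul hQ).deriv
    refine h.trans ?_
    rw [sechPoly_succ, sechOp]
    simp only [map_sub, map_mul, map_one, map_pow, aeval_X, map_natCast, Pi.pow_apply,
      Function.comp, Pi.inv_apply, Pi.div_apply]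
    generalize aeval (Complex.sinh z / Complex.cosh z) (sechPoly α n) = a
    generalize aeval (Complex.sinh z / Complex.cosh z) (derivative (sechPoly α n)) = b
    have h1 := Complex.cosh_sq_sub_sinh_sq z
    generalize Complex.cosh z = c at *
    generalize Complex.sinh z = s at *
    rcases α with _ | m
    · simp; field_simp
    · simp only [Nat.add_sub_cancel, pow_succ c⁻¹ m]
      field_simp
      ring

/-- Normalized derivatives of `sech^α` are asymptotically cosines, uniformly on compact sets. -/
def SechAsymptotics (j : ℕ) : Prop :=
  ∃ β : ℝ, ∀ y₁ y₂ ε : ℝ, 0 < y₁ → y₂ < 1 → 0 < ε → ∀ᶠ N : ℕ in atTop, ∀ y ∈ Set.Icc y₁ y₂,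
    |(-1) ^ (N + j) * (Real.pi / (2 * Real.cos (Real.pi / 2 * y))) ^ (N + j + 1) /
          (2 * (N + j).factorial) *
        ((Real.cosh (Real.pi / 2 * Real.tan (Real.pi / 2 * y)))⁻¹ ^ (j + 1) *
          (sechPoly (j + 1) N).eval (Real.tanh (Real.pi / 2 * Real.tan (Real.pi / 2 * y)))) -
      Real.cos (((N + j : ℕ) + 1) * (Real.pi / 2 * (1 - y)) - β)| ≤ ε

/-- Writing `sech^(j+1)` as the `j`-th derivative of some `G / cosh` reduces to simple poles, at the
price of the shift from `N` to `N + j`. The phase `β` is read off from the residues `exp(∓iβ)`. -/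
lemma sechAsymptotics_of_iteratedDeriv {j : ℕ} {G : ℂ → ℂ} (hG : Differentiable ℂ G) {β : ℝ}
    (hp : G (Real.pi / 2 * Complex.I) / Complex.sinh (Real.pi / 2 * Complex.I) =
      Complex.exp (-β * Complex.I))
    (hq : G (-(Real.pi / 2 * Complex.I)) / Complex.sinh (-(Real.pi / 2 * Complex.I)) =
      Complex.exp (β * Complex.I))
    (h : ∀ z, Complex.cosh z ≠ 0 →
      iteratedDeriv j (fun z => G z / Complex.cosh z) z = (Complex.cosh z)⁻¹ ^ (j + 1)) :
    SechAsymptotics j := by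
  refine ⟨β, fun y₁ y₂ ε hy₁ hy₂ hε => ?_⟩
  have := eventually_norm_iteratedDeriv_div_cosh_sub_cos_le hG hp hq hy₁ hy₂ hε
  filter_upwards [(tendsto_add_atTop_nat j).eventually this] with N hN y hy
  have hN := hN y hy
  set t := Real.pi / 2 * Real.tan (Real.pi / 2 * y)
  have ht := cosh_ofReal_ne_zero t
  have h1 : iteratedDeriv (N + j) (fun z => G z / Complex.cosh z) (t : ℂ) =
      (((Real.cosh t)⁻¹ ^ (j + 1) * (sechPoly (j + 1) N).eval (Real.tanh t) : ℝ) : ℂ) := by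
    have heq : iteratedDeriv j (fun z => G z / Complex.cosh z) =ᶠ[𝓝 (t : ℂ)]
        fun z => (Complex.cosh z)⁻¹ ^ (j + 1) := (eventually_cosh_ne_zero ht).mono h
    rw [iteratedDeriv_eq_iterate, Function.iterate_add_apply, ← iteratedDeriv_eq_iterate,
      ← iteratedDeriv_eq_iterate, heq.iteratedDeriv_eq, iteratedDeriv_sech_pow _ _ ht]
    rw [← Complex.tanh_eq_sinh_div_cosh, ← Complex.ofReal_tanh, ← Complex.coe_algebraMap,
      aeval_algebraMap_apply]
    simp
  rw [h1, ← Complex.ofReal_mul, ← Complex.ofReal_sub, Complex.norm_real, Real.norm_eq_abs] at hN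
  exact hN

/-- The residues of `sech` at `±iπ/2` are `∓i = exp(∓iπ/2)`. -/
lemma sechAsymptotics_zero : SechAsymptotics 0 := by
  refine sechAsymptotics_of_iteratedDeriv (G := fun _ => 1) (β := Real.pi / 2)
    (differentiable_const _) ?_ ?_ fun z _ => by simp
  · rw [Complex.sinh_half_pi_mul_I]; push_cast
    rw [neg_mul, Complex.exp_neg, Complex.exp_pi_div_two_mul_I]; simp
  · rw [Complex.sinh_neg, Complex.sinh_half_pi_mul_I]; push_cast
    rw [Complex.exp_pi_div_two_mul_I]; simp

/-- `sech²` is the derivative of `tanh`, whose residues are `1`. -/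
lemma sechAsymptotics_one : SechAsymptotics 1 := by
  have h : Complex.sinh (Real.pi / 2 * Complex.I) ≠ 0 := by
    rw [Complex.sinh_half_pi_mul_I]; exact Complex.I_ne_zero
  refine sechAsymptotics_of_iteratedDeriv (G := Complex.sinh) (β := 0)
    Complex.differentiable_sinh ?_ ?_ fun z hz => ?_
  · simp [h]
  · simp [h, Complex.sinh_neg]
  · have := ((Complex.hasDerivAt_sinh z).div (Complex.hasDerivAt_cosh z) hz).deriv
    rw [iteratedDeriv_one]
    refine this.trans ?_
    have h1 := Complex.cosh_sq_sub_sinh_sq z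
    rw [← sq, ← sq, h1]
    simp

/-! ### Counting zeros by sign changes. -/

/-- A continuous function close to a cosine has at least as many zeros, up to `2`. -/
lemma exists_zeros_of_abs_sub_cos_le {f : ℝ → ℝ} {y₁ y₂ M β : ℝ} (hM : 0 < M)
    (hf : ContinuousOn f (Set.Icc y₁ y₂))
    (h : ∀ y ∈ Set.Icc y₁ y₂, |f y - Real.cos (M * (Real.pi / 2 * (1 - y)) - β)| ≤ 1 / 2) :
    ∃ T : Finset ℝ, M * (y₂ - y₁) / 2 - 2 ≤ T.card ∧ ∀ y ∈ T, y₁ < y ∧ y < y₂ ∧ f y = 0 := by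
  classical
  have hpi := Real.pi_pos
  -- The nodes, decreasing in `k`, are where the phase equals `kπ`; there the cosine is `(-1)^k`,
  -- and an error of `1/2` leaves the sign of `f` unchanged.
  set node : ℤ → ℝ := fun k => 1 - 2 / (M * Real.pi) * (k * Real.pi + β) with hnode
  have hphase : ∀ k : ℤ, M * (Real.pi / 2 * (1 - node k)) - β = k * Real.pi := fun k => by
    rw [hnode]; field_simp; ring
  have hanti : ∀ k l : ℤ, node k < node l ↔ l < k := fun k l => by
    simp only [hnode, sub_lt_sub_iff_left]
    rw [mul_lt_mul_iff_right₀ (by positivity), add_lt_add_iff_right,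
      mul_lt_mul_iff_left₀ hpi, Int.cast_lt]
  have hinj : Function.Injective node := fun k l hkl => by
    rcases lt_trichotomy k l with h | h | h
    · exact absurd hkl ((hanti l k).2 h).ne'
    · exact h
    · exact absurd hkl ((hanti k l).2 h).ne
  set a := (M * (Real.pi / 2 * (1 - y₂)) - β) / Real.pi with ha
  set b := (M * (Real.pi / 2 * (1 - y₁)) - β) / Real.pi with hb
  have hab : b - a = M * (y₂ - y₁) / 2 := by rw [ha, hb]; field_simp; ring
  have hmem : ∀ k ∈ Finset.Icc ⌈a⌉ ⌊b⌋, node k ∈ Set.Icc y₁ y₂ := by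
    intro k hk
    rw [Finset.mem_Icc, Int.ceil_le, Int.le_floor] at hk
    have h1 := hk.1
    have h2 := hk.2
    rw [ha, div_le_iff₀ hpi, ← hphase] at h1
    rw [hb, le_div_iff₀ hpi, ← hphase] at h2
    have hMpi : 0 < M * Real.pi := by positivity
    constructor <;> nlinarith
  set S : Finset ℝ := (Finset.Icc ⌈a⌉ ⌊b⌋).image node with hS
  -- Rounding `a` and `b` to integers costs one node, and passing from nodes to gaps costs one more:
  -- hence the `- 2`.
  have hcard : b - a - 1 ≤ S.card := by
    rw [hS, Finset.card_image_of_injective _ hinj, Int.card_Icc]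
    have h1 := Int.ceil_lt_add_one a
    have h2 := Int.lt_floor_add_one b
    have h3 : ((⌊b⌋ + 1 - ⌈a⌉ : ℤ) : ℝ) ≤ ((⌊b⌋ + 1 - ⌈a⌉).toNat : ℝ) := by
      exact_mod_cast Int.self_le_toNat _
    push_cast at h3
    linarith
  have hsign : ∀ k : ℤ, node k ∈ Set.Icc y₁ y₂ → (Even k → 0 < f (node k)) ∧
      (Odd k → f (node k) < 0) := by
    intro k hk
    have h1 := h _ hk
    rw [hphase, Real.cos_int_mul_pi, abs_le] at h1
    constructor
    · intro hev; rw [hev.neg_one_zpow] at h1; linarith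
    · intro hodd; rw [hodd.neg_one_zpow] at h1; linarith
  obtain ⟨T, hT, hTS⟩ := exists_finset_card_le_of_forall_exists_between
    (p := fun y => f y = 0) S (by
      intro x hx y hy hxy
      obtain ⟨k, hk, rfl⟩ := Finset.mem_image.1 hx
      obtain ⟨l, hl, rfl⟩ := Finset.mem_image.1 hy
      have hlk := (hanti k l).1 hxy
      have hk' := hmem k hk
      have hl' := hmem l hl
      -- `node k` and `node l` need not be adjacent, so the sign change is taken between `node l`
      -- and its left neighbour `node (l + 1)`.
      have hle : node k ≤ node (l + 1) := by
        by_contra! hlt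
        have := (hanti _ _).1 hlt
        omega
      have hlt : node (l + 1) < node l := (hanti _ _).2 (by omega)
      have hl1 : node (l + 1) ∈ Set.Icc y₁ y₂ := ⟨hk'.1.trans hle, hlt.le.trans hl'.2⟩
      have hcont : ContinuousOn f (Set.Icc (node (l + 1)) (node l)) :=
        hf.mono (Set.Icc_subset_Icc hl1.1 hl'.2)
      have : ∃ z ∈ Set.Ioo (node (l + 1)) (node l), f z = 0 := by
        rcases Int.even_or_odd l with hev | hodd
        · exact intermediate_value_Ioo hlt.le hcont
            ⟨(hsign _ hl1).2 hev.add_one, (hsign _ hl').1 hev⟩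
        · exact intermediate_value_Ioo' hlt.le hcont
            ⟨(hsign _ hl').2 hodd, (hsign _ hl1).1 hodd.add_one⟩
      obtain ⟨z, hz, hz0⟩ := this
      exact ⟨z, hle.trans_lt hz.1, hz.2, hz0⟩)
  refine ⟨T, ?_, fun y hy => ?_⟩
  · have : (S.card : ℝ) ≤ T.card + 1 := by exact_mod_cast hT
    linarith
  · obtain ⟨h0, ⟨x, hx, hxy⟩, z, hz, hyz⟩ := hTS y hy
    obtain ⟨k, hk, rfl⟩ := Finset.mem_image.1 hx
    obtain ⟨l, hl, rfl⟩ := Finset.mem_image.1 hz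
    exact ⟨(hmem k hk).1.trans_lt hxy, hyz.trans_le (hmem l hl).2, h0⟩

lemma eventually_exists_zeros_sechPoly_add {j : ℕ} (hj : SechAsymptotics j) (e : ℝ)
    {y₁ y₂ : ℝ} (hy₁ : 0 < y₁) (hy₁₂ : y₁ < y₂) (hy₂ : y₂ < 1) :
    ∀ᶠ m : ℕ in atTop, ∃ T : Finset ℝ, (m + 1) * (y₂ - y₁) / 2 - 2 ≤ T.card ∧
      ∀ y ∈ T, y₁ < y ∧ y < y₂ ∧
        (sechPoly (j + 1) (m + 2) + C e * sechPoly (j + 1) m).eval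
          (Real.tanh (Real.pi / 2 * Real.tan (Real.pi / 2 * y))) = 0 := by
  have hpi := Real.pi_pos
  obtain ⟨β, hβ⟩ := hj
  have hev := hβ y₁ y₂ (1 / 4) hy₁ hy₂ (by norm_num)
  have hcos : ∀ y ∈ Set.Icc y₁ y₂, 0 < Real.cos (Real.pi / 2 * y) := fun y hy =>
    cos_half_pi_mul_pos (hy₁.trans_le hy.1) (hy.2.trans_lt hy₂)
  have hρcont : ContinuousOn (fun y => Real.pi / (2 * Real.cos (Real.pi / 2 * y)))
      (Set.Icc y₁ y₂) := by
    refine ContinuousOn.div (by fun_prop) (by fun_prop) fun y hy => ?_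
    exact (mul_pos two_pos (hcos y hy)).ne'
  have htcont : ContinuousOn (fun y => Real.pi / 2 * Real.tan (Real.pi / 2 * y))
      (Set.Icc y₁ y₂) := by
    simp only [Real.tan_eq_sin_div_cos]
    exact continuousOn_const.mul (ContinuousOn.div (by fun_prop) (by fun_prop)
      fun y hy => (hcos y hy).ne')
  obtain ⟨D, hD⟩ := isCompact_Icc.exists_bound_of_continuousOn hρcont
  have hlim : Tendsto (fun m : ℕ => |e| * D ^ 2 * 2 * ((m : ℝ) + 1)⁻¹) atTop (𝓝 0) := by
    have h := (tendsto_natCast_atTop_atTop (R := ℝ)).atTop_add (tendsto_const_nhds (x := (1 : ℝ)))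
    simpa using (tendsto_inv_atTop_zero.comp h).const_mul (|e| * D ^ 2 * 2)
  filter_upwards [hev, (tendsto_add_atTop_nat 2).eventually hev,
    hlim.eventually (ge_mem_nhds (show (0 : ℝ) < 1 / 4 by norm_num))] with m hm hm2 hme
  set g : ℕ → ℝ → ℝ := fun N y =>
    (-1) ^ (N + j) * (Real.pi / (2 * Real.cos (Real.pi / 2 * y))) ^ (N + j + 1) /
          (2 * (N + j).factorial) *
        ((Real.cosh (Real.pi / 2 * Real.tan (Real.pi / 2 * y)))⁻¹ ^ (j + 1) *
          (sechPoly (j + 1) N).eval (Real.tanh (Real.pi / 2 * Real.tan (Real.pi / 2 * y)))) with hg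
  have hgcont : ∀ N, ContinuousOn (g N) (Set.Icc y₁ y₂) := fun N => by
    refine ((continuousOn_const.mul (hρcont.pow _)).div_const _).mul (ContinuousOn.mul ?_ ?_)
    · refine ContinuousOn.pow (ContinuousOn.inv₀ (Real.continuous_cosh.comp_continuousOn htcont)
        fun y _ => (Real.cosh_pos _).ne') _
    · refine (Polynomial.continuous _).comp_continuousOn (ContinuousOn.congr
        (f := fun y => Real.sinh (Real.pi / 2 * Real.tan (Real.pi / 2 * y)) /
          Real.cosh (Real.pi / 2 * Real.tan (Real.pi / 2 * y))) ?_
        fun y _ => Real.tanh_eq_sinh_div_cosh _)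
      exact (Real.continuous_sinh.comp_continuousOn htcont).div
        (Real.continuous_cosh.comp_continuousOn htcont) fun y _ => (Real.cosh_pos _).ne'
  -- `κ` is `e` times the ratio of the normalizing factors of orders `m + 2` and `m`. It is `O(1/m)`
  -- uniformly in `y`, so the lower-order term adds at most `1/4` to the error `1/4` of the main
  -- one.
  set κ : ℝ → ℝ := fun y => e * (Real.pi / (2 * Real.cos (Real.pi / 2 * y))) ^ 2 /
    (((m + j : ℕ) + 2) * ((m + j : ℕ) + 1)) with hκ
  have hfcont : ContinuousOn (fun y => g (m + 2) y + κ y * g m y) (Set.Icc y₁ y₂) :=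
    (hgcont _).add (((continuousOn_const.mul (hρcont.pow 2)).div_const _).mul (hgcont m))
  have hM : (0 : ℝ) < ((m + 2 + j : ℕ) : ℝ) + 1 := by positivity
  obtain ⟨T, hTcard, hT⟩ := exists_zeros_of_abs_sub_cos_le (β := β) hM hfcont (by
    intro y hy
    have h1 := hm y hy
    have h2 := hm2 y hy
    have hgm : |g m y| ≤ 2 := by
      have h3 := Real.abs_cos_le_one (((m + j : ℕ) + 1) * (Real.pi / 2 * (1 - y)) - β)
      have h4 := abs_sub_abs_le_abs_sub (g m y)
        (Real.cos (((m + j : ℕ) + 1) * (Real.pi / 2 * (1 - y)) - β))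
      simp only [hg] at h4 ⊢
      linarith
    have hκm : |κ y| ≤ |e| * D ^ 2 * ((m : ℝ) + 1)⁻¹ := by
      have hDy := hD y hy
      rw [Real.norm_eq_abs] at hDy
      have hden : (m : ℝ) + 1 ≤ ((m + j : ℕ) + 2) * ((m + j : ℕ) + 1) := by
        push_cast
        nlinarith [(Nat.cast_nonneg m : (0 : ℝ) ≤ m), (Nat.cast_nonneg j : (0 : ℝ) ≤ j),
          mul_nonneg (Nat.cast_nonneg m : (0 : ℝ) ≤ m) (Nat.cast_nonneg j : (0 : ℝ) ≤ j)]
      rw [hκ]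
      simp only
      rw [abs_div, abs_mul, abs_pow, ← div_eq_mul_inv,
        abs_of_pos (by positivity : (0 : ℝ) < ((m + j : ℕ) + 2) * ((m + j : ℕ) + 1))]
      gcongr
    have hprod : |κ y * g m y| ≤ 1 / 4 := by
      rw [abs_mul]
      calc |κ y| * |g m y| ≤ |e| * D ^ 2 * ((m : ℝ) + 1)⁻¹ * 2 := by gcongr
        _ = |e| * D ^ 2 * 2 * ((m : ℝ) + 1)⁻¹ := by ring
        _ ≤ 1 / 4 := hme
    change |g (m + 2) y - _| ≤ _ at h2
    rw [add_sub_right_comm]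
    refine (abs_add_le _ _).trans ?_
    linarith)
  refine ⟨T, ?_, fun y hy => ?_⟩
  · refine le_trans ?_ hTcard
    have : (m : ℝ) + 1 ≤ ((m + 2 + j : ℕ) : ℝ) + 1 := by
      push_cast; linarith [(Nat.cast_nonneg j : (0 : ℝ) ≤ j)]
    have hsub : 0 < y₂ - y₁ := by linarith
    gcongr
  · obtain ⟨h1, h2, h3⟩ := hT y hy
    refine ⟨h1, h2, ?_⟩
    have hcy := hcos y ⟨h1.le, h2.le⟩
    have hfac : ((m + 2 + j).factorial : ℝ) =
        ((m + j : ℕ) + 2) * ((m + j : ℕ) + 1) * (m + j).factorial := by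
      rw [show m + 2 + j = m + j + 1 + 1 by ring, Nat.factorial_succ, Nat.factorial_succ]
      push_cast; ring
    have hcosh := Real.cosh_pos (Real.pi / 2 * Real.tan (Real.pi / 2 * y))
    have hρ : 0 < Real.pi / (2 * Real.cos (Real.pi / 2 * y)) := by positivity
    have hcoef : (-1 : ℝ) ^ (m + 2 + j) *
        (Real.pi / (2 * Real.cos (Real.pi / 2 * y))) ^ (m + 2 + j + 1) /
          (2 * (m + 2 + j).factorial) *
        (Real.cosh (Real.pi / 2 * Real.tan (Real.pi / 2 * y)))⁻¹ ^ (j + 1) ≠ 0 := by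
      have : ((-1 : ℝ) ^ (m + 2 + j)) ≠ 0 := by simp
      positivity
    refine (mul_eq_zero.1 (Eq.trans ?_ h3)).resolve_left hcoef
    simp only [hg, hκ, eval_add, eval_mul, eval_C, hfac]
    rw [show m + 2 + j = m + j + 2 by ring, show m + j + 2 + 1 = m + j + 1 + 2 by ring,
      pow_add (-1 : ℝ) (m + j) 2, pow_add _ (m + j + 1) 2]
    generalize Real.pi / (2 * Real.cos (Real.pi / 2 * y)) = ρ at *
    generalize (sechPoly (j + 1) (m + 2)).eval _ = u
    generalize (sechPoly (j + 1) m).eval _ = v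
    field_simp

/-- The lower bound on the number of zeros in `(limitQuantile y₁, limitQuantile y₂)`. -/
lemma eventually_exists_roots_iterSeq_tanhOp {j : ℕ} (hj : SechAsymptotics j) (a : ℕ → ℝ)
    (c d : ℝ) (hc : c ≠ 0) (ha : ∀ n, 1 ≤ n → a n ≠ 0)
    {y₁ y₂ : ℝ} (hy₁ : 0 < y₁) (hy₁₂ : y₁ < y₂) (hy₂ : y₂ < 1) :
    ∀ᶠ n : ℕ in atTop, ∃ T : Finset ℝ, n * (y₂ - y₁) - 2 ≤ T.card ∧
      ∀ x ∈ T, (iterSeq (tanhOp (j + 1)) a c d n).IsRoot x ∧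
        limitQuantile y₁ < x ∧ x < limitQuantile y₂ := by
  classical
  obtain ⟨e, he⟩ := exists_iterSeq_tanhOp_comp_eq (α := j + 1) (by omega) a c d hc ha
  have htend : Tendsto (fun n : ℕ => 2 * n - 1) atTop atTop :=
    tendsto_atTop_mono (fun n => by omega) (tendsto_sub_atTop_nat 1)
  filter_upwards [htend.eventually (eventually_exists_zeros_sechPoly_add hj e hy₁ hy₁₂ hy₂),
    eventually_ge_atTop 1] with n hn hn1
  obtain ⟨T, hTcard, hT⟩ := hn
  obtain ⟨k, hk, hk'⟩ := he n hn1
  have h0 : ∀ y ∈ T, 0 < y ∧ y < 1 := fun y hy =>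
    ⟨hy₁.trans (hT y hy).1, (hT y hy).2.1.trans hy₂⟩
  refine ⟨T.image limitQuantile, ?_, fun x hx => ?_⟩
  · rw [Finset.card_image_of_injOn]
    -- Here `m = 2n - 1`, so `(m + 1) / 2 = n`.
    · refine le_trans (le_of_eq ?_) hTcard
      rw [Nat.cast_sub (by omega)]
      push_cast; ring
    · intro y hy z hz hyz
      rcases lt_trichotomy y z with h | h | h
      · exact absurd hyz (limitQuantile_lt (h0 y hy).1 h (h0 z hz).2).ne
      · exact h
      · exact absurd hyz (limitQuantile_lt (h0 z hz).1 h (h0 y hy).2).ne'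
  · obtain ⟨y, hy, rfl⟩ := Finset.mem_image.1 hx
    obtain ⟨h1, h2, h3⟩ := hT y hy
    refine ⟨?_, limitQuantile_lt hy₁ h1 (h0 y hy).2, limitQuantile_lt (h0 y hy).1 h2 hy₂⟩
    rw [show 2 * n - 1 + 2 = 2 * n + 1 by omega] at h3
    have := congrArg (eval (Real.tanh (Real.pi / 2 * Real.tan (Real.pi / 2 * y)))) hk'
    rw [eval_mul, eval_mul, h3, mul_zero, eval_X, eval_comp, eval_pow, eval_X] at this
    refine (mul_eq_zero.1 this).resolve_left fun htanh => ?_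
    have hpos := (limitQuantile_mem_Ioo (h0 y hy).1 (h0 y hy).2).1
    rw [limitQuantile, htanh] at hpos
    norm_num at hpos

/-! ### Convergence of the empirical distribution functions. -/

lemma limitQuantile_le_of_lt_limitCdf {x y : ℝ} (h0 : 0 < y) (h1 : y < 1) (h : y < limitCdf x) :
    limitQuantile y ≤ x := by
  rcases le_or_gt 1 x with hx1 | hx1
  · exact (limitQuantile_mem_Ioo h0 h1).2.le.trans hx1
  rcases le_or_gt x 0 with hx0 | hx0
  · rw [limitCdf_of_nonpos hx0] at h; linarith
  · have := limitQuantile_lt h0 h (limitCdf_mem_Ioo hx0 hx1).2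
    rw [limitQuantile_limitCdf hx0 hx1] at this
    exact this.le

lemma le_limitQuantile_of_limitCdf_lt {x y : ℝ} (h0 : 0 < y) (h1 : y < 1) (h : limitCdf x < y) :
    x ≤ limitQuantile y := by
  rcases le_or_gt 1 x with hx1 | hx1
  · rw [limitCdf_of_one_le hx1] at h; linarith
  rcases le_or_gt x 0 with hx0 | hx0
  · exact hx0.trans (limitQuantile_mem_Ioo h0 h1).1.le
  · have := limitQuantile_lt (limitCdf_mem_Ioo hx0 hx1).1 h h1
    rw [limitQuantile_limitCdf hx0 hx1] at this
    exact this.le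

lemma limitCdf_mem_Icc (x : ℝ) : 0 ≤ limitCdf x ∧ limitCdf x ≤ 1 := by
  rcases le_or_gt 1 x with hx1 | hx1
  · simp [limitCdf_of_one_le hx1]
  rcases le_or_gt x 0 with hx0 | hx0
  · simp [limitCdf_of_nonpos hx0]
  · exact ⟨(limitCdf_mem_Ioo hx0 hx1).1.le, (limitCdf_mem_Ioo hx0 hx1).2.le⟩

/-- Lower bounds for the number of zeros between any two quantiles imply convergence of the
empirical distribution functions. -/
lemma tendsto_zeroCdf_of_eventually_exists_roots {p : ℕ → ℝ[X]}
    (hdeg : ∀ n, 1 ≤ n → (p n).natDegree = n) (hroots : ∀ n, 1 ≤ n → (p n).roots.card = n)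
    (h : ∀ y₁ y₂ : ℝ, 0 < y₁ → y₁ < y₂ → y₂ < 1 → ∀ᶠ n : ℕ in atTop, ∃ T : Finset ℝ,
      n * (y₂ - y₁) - 2 ≤ T.card ∧
      ∀ x ∈ T, (p n).IsRoot x ∧ limitQuantile y₁ < x ∧ x < limitQuantile y₂) (x : ℝ) :
    Tendsto (fun n => zeroCdf (p n) x) atTop (𝓝 (limitCdf x)) := by
  have hF := limitCdf_mem_Icc x
  have hne : ∀ n, 1 ≤ n → p n ≠ 0 := fun n hn => ne_zero_of_natDegree_gt (n := 0) (by
    rw [hdeg n hn]; omega)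
  have hlim : Tendsto (fun n : ℕ => 2 * ((n : ℝ))⁻¹) atTop (𝓝 0) := by
    simpa using (tendsto_inv_atTop_nhds_zero_nat (𝕜 := ℝ)).const_mul 2
  have hlower : ∀ ε > 0, ∀ᶠ n in atTop, limitCdf x - ε ≤ zeroCdf (p n) x := by
    intro ε hε
    rcases hF.1.eq_or_lt with h0 | h0
    · refine Eventually.of_forall fun n => ?_
      have : 0 ≤ zeroCdf (p n) x := by unfold zeroCdf; positivity
      linarith
    -- The interval `(δ, F(x) - δ)` loses `2δ ≤ ε/2`; the other `ε/2` absorbs the `2/n` from the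
    -- zero count. Also `4δ ≤ F(x)` keeps the interval nonempty.
    set δ := min ε (limitCdf x) / 4 with hδ
    have hδ0 : 0 < δ := by positivity
    have hδε : 4 * δ ≤ ε := by rw [hδ]; linarith [min_le_left ε (limitCdf x)]
    have hδF : 4 * δ ≤ limitCdf x := by rw [hδ]; linarith [min_le_right ε (limitCdf x)]
    filter_upwards [h δ (limitCdf x - δ) hδ0 (by linarith) (by linarith), eventually_ge_atTop 1,
      hlim.eventually (ge_mem_nhds (show 0 < ε / 2 by positivity))] with n hn hn1 hnε
    obtain ⟨T, hTcard, hT⟩ := hn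
    have hq := limitQuantile_le_of_lt_limitCdf (x := x) (y := limitCdf x - δ) (by linarith)
      (by linarith) (by linarith)
    have hcount := finset_card_le_countP_roots (hne n hn1) T (fun t => t ≤ x) fun t ht =>
      ⟨(hT t ht).1, (hT t ht).2.2.le.trans hq⟩
    have hcount' : (T.card : ℝ) ≤ (p n).roots.countP (fun t => t ≤ x) := by exact_mod_cast hcount
    have hn0 : (0 : ℝ) < n := by exact_mod_cast hn1
    rw [← div_eq_mul_inv, div_le_iff₀ hn0] at hnε
    rw [zeroCdf, hdeg n hn1, le_div_iff₀ hn0]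
    nlinarith
  -- The upper bound is the lower bound for zeros exceeding `x`, subtracted from the total; this is
  -- where it matters that all `n` zeros are real.
  have hupper : ∀ ε > 0, ∀ᶠ n in atTop, zeroCdf (p n) x ≤ limitCdf x + ε := by
    intro ε hε
    have hle : ∀ n, 1 ≤ n → ((p n).roots.countP (fun t => t ≤ x) : ℝ) +
        (p n).roots.countP (fun t => ¬ t ≤ x) = n := fun n hn => by
      have hcard := Multiset.card_eq_countP_add_countP (fun t => t ≤ x) (p n).roots
      rw [hroots n hn] at hcard
      exact_mod_cast hcard.symm
    rcases hF.2.eq_or_lt with h1 | h1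
    · filter_upwards [eventually_ge_atTop 1] with n hn
      have hn0 : (0 : ℝ) < n := by exact_mod_cast hn
      have : zeroCdf (p n) x ≤ 1 := by
        rw [zeroCdf, hdeg n hn, div_le_one hn0, ← hle n hn]
        exact le_add_of_nonneg_right (Nat.cast_nonneg _)
      linarith
    set δ := min ε (1 - limitCdf x) / 4 with hδ
    have hδ0 : 0 < δ := by
      have : 0 < 1 - limitCdf x := by linarith
      positivity
    have hδε : 4 * δ ≤ ε := by rw [hδ]; linarith [min_le_left ε (1 - limitCdf x)]
    have hδF : 4 * δ ≤ 1 - limitCdf x := by rw [hδ]; linarith [min_le_right ε (1 - limitCdf x)]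
    filter_upwards [h (limitCdf x + δ) (1 - δ) (by linarith) (by linarith) (by linarith),
      eventually_ge_atTop 1,
      hlim.eventually (ge_mem_nhds (show 0 < ε / 2 by positivity))] with n hn hn1 hnε
    obtain ⟨T, hTcard, hT⟩ := hn
    have hq := le_limitQuantile_of_limitCdf_lt (x := x) (y := limitCdf x + δ) (by linarith)
      (by linarith) (by linarith)
    have hcount := finset_card_le_countP_roots (hne n hn1) T (fun t => ¬ t ≤ x) fun t ht =>
      ⟨(hT t ht).1, not_le.2 (hq.trans_lt (hT t ht).2.1)⟩
    have hcount' : (T.card : ℝ) ≤ (p n).roots.countP (fun t => ¬ t ≤ x) := by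
      exact_mod_cast hcount
    have hn0 : (0 : ℝ) < n := by exact_mod_cast hn1
    have hsum := hle n hn1
    rw [← div_eq_mul_inv, div_le_iff₀ hn0] at hnε
    rw [zeroCdf, hdeg n hn1, div_le_iff₀ hn0]
    nlinarith
  rw [Metric.tendsto_nhds]
  intro ε hε
  filter_upwards [hlower (ε / 2) (by positivity), hupper (ε / 2) (by positivity)] with n h1 h2
  rw [Real.dist_eq, abs_lt]
  constructor <;> linarith

lemma tendsto_zeroCdf_iterSeq_tanhOp {j : ℕ} (hj : SechAsymptotics j) (a : ℕ → ℝ)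
    (c d : ℝ) (hc : c ≠ 0) (ha : ∀ n, 1 ≤ n → a n ≠ 0) (x : ℝ) :
    Tendsto (fun n => zeroCdf (iterSeq (tanhOp (j + 1)) a c d n) x) atTop (𝓝 (limitCdf x)) :=
  tendsto_zeroCdf_of_eventually_exists_roots
    (fun _ hn => natDegree_iterSeq_tanhOp (by omega) a c d hc ha hn)
    (fun _ hn => card_roots_iterSeq_tanhOp (by omega) a c d hc ha hn)
    (fun _ _ h1 h2 h3 => eventually_exists_roots_iterSeq_tanhOp hj a c d hc ha h1 h2 h3) x

lemma measureReal_limitMeasure_Iic (x : ℝ) : limitMeasure.real (Set.Iic x) = limitCdf x := by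
  rw [Measure.real, limitMeasure_Iic, ENNReal.toReal_ofReal (limitCdf_mem_Icc x).1]

lemma tendsto_zeroMeasure_iterSeq_tanhOp {j : ℕ} (hj : SechAsymptotics j) (a : ℕ → ℝ)
    (c d : ℝ) (hc : c ≠ 0) (ha : ∀ n, 1 ≤ n → a n ≠ 0) :
    Tendsto (fun n => zeroMeasure (iterSeq (tanhOp (j + 1)) a c d n)) atTop
      (𝓝 (ProbabilityMeasure.toFiniteMeasure ⟨limitMeasure, inferInstance⟩)) :=
  tendsto_zeroMeasure_of_tendsto_zeroCdf
    (fun _ hn => natDegree_iterSeq_tanhOp (by omega) a c d hc ha hn)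
    (fun _ hn => card_roots_iterSeq_tanhOp (by omega) a c d hc ha hn)
    fun x => by
      rw [ProbabilityMeasure.coe_mk, measureReal_limitMeasure_Iic]
      exact tendsto_zeroCdf_iterSeq_tanhOp hj a c d hc ha x

theorem mainTheorem3 :
    ∃ μ : ProbabilityMeasure ℝ,
      (μ : Measure ℝ) (Set.Ioo 0 1) = 1 ∧
      -- `μ` is the weak limit of the empirical zero measures of all the sequences
      (∀ (c d : ℝ) (A B : ℕ → ℝ), c ≠ 0 → (∀ n, 1 ≤ n → A n ≠ 0) → (∀ n, 1 ≤ n → B n ≠ 0) →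
        (∀ n, 1 ≤ n →
          (PXi A c d n).natDegree = n ∧ (PXi A c d n).roots.card = n ∧
          (PLambda B c d n).natDegree = n ∧ (PLambda B c d n).roots.card = n) ∧
        Tendsto (fun n => zeroMeasure (PXi A c d n)) atTop (𝓝 μ.toFiniteMeasure) ∧
        Tendsto (fun n => zeroMeasure (PLambda B c d n)) atTop (𝓝 μ.toFiniteMeasure)) ∧
      -- its density
      (μ : Measure ℝ) ≪ (volume : Measure ℝ) ∧
      (μ : Measure ℝ) =
        (volume : Measure ℝ).withDensity (fun x => ENNReal.ofReal (limitDensity x)) ∧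
      -- its distribution function
      (∀ x : ℝ, ProbabilityTheory.cdf (μ : Measure ℝ) x = limitCdf x) ∧
      -- convergence of the empirical distribution functions
      (∀ (c d : ℝ) (A B : ℕ → ℝ), c ≠ 0 → (∀ n, 1 ≤ n → A n ≠ 0) → (∀ n, 1 ≤ n → B n ≠ 0) →
        ∀ x : ℝ, ContinuousAt limitCdf x →
          Tendsto (fun n => zeroCdf (PXi A c d n) x) atTop (𝓝 (limitCdf x)) ∧
          Tendsto (fun n => zeroCdf (PLambda B c d n) x) atTop (𝓝 (limitCdf x))) := by
  simp only [PXi, PLambda, opXi_eq_tanhOp, opLambda_eq_tanhOp]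
  refine ⟨⟨limitMeasure, inferInstance⟩, limitMeasure_Ioo, ?_, withDensity_absolutelyContinuous _ _,
    rfl, ?_, ?_⟩
  · intro c d A B hc hA hB
    exact ⟨fun n hn => ⟨natDegree_iterSeq_tanhOp le_rfl A c d hc hA hn,
        card_roots_iterSeq_tanhOp le_rfl A c d hc hA hn,
        natDegree_iterSeq_tanhOp one_le_two B c d hc hB hn,
        card_roots_iterSeq_tanhOp one_le_two B c d hc hB hn⟩,
      tendsto_zeroMeasure_iterSeq_tanhOp sechAsymptotics_zero A c d hc hA,
      tendsto_zeroMeasure_iterSeq_tanhOp sechAsymptotics_one B c d hc hB⟩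
  · intro x
    exact (ProbabilityTheory.cdf_eq_real limitMeasure x).trans (measureReal_limitMeasure_Iic x)
  · intro c d A B hc hA hB x _
    exact ⟨tendsto_zeroCdf_iterSeq_tanhOp sechAsymptotics_zero A c d hc hA x,
      tendsto_zeroCdf_iterSeq_tanhOp sechAsymptotics_one B c d hc hB x⟩
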